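/- Let $H\in(0,1)$ and let $(B_H(t))_{t\in\mathbb R}$ be a fractional Brownian motion with Hurst parameter $H$ and scaling coefficient $C=1$: a centered Gaussian process with stationary increments and $\operatorname{Var} B_H(t)=|t|^{2H}$. Let $a=(a_0,\dots,a_\ell)$ be a real filter of order $p\ge 2$, i.e. $\sum_{q=0}^{\ell} q^j a_q=0$ for $0\le j\le p-1$ and $\sum_{q=0}^{\ell} q^p a_q\ne 0$ (with $0^0=1$). With $0\log 0=0$, assume $$\tau^a:=\sum_{q,r=0}^{\ell}a_qa_r(q-r)^2\log|q-r|\neq 0 .$$ For $x\in(0,1)$ and $j\in\mathbb Z$ put $\pi_x^a(j)=-\frac12\sum_{q,r=0}^{\ell}a_qa_r|q-r+j|^{2x}$, $\rho_x^a(j)=\pi_x^a(j)/\pi_x^a(0)$, and $\kappa^a=2\sup_{x\in(0,1)}\sum_{j\in\mathbb Z}|\rho_x^a(j)|$. For $n\ge \ell+1$ let $$V^a(i/n)=\sum_{q=0}^{\ell}a_qB_H\Big(\frac{i-q}{n}\Big),\qquad S_n^a=\frac1{n-\ell}\sum_{i=\ell}^{n-1}V^a(i/n)^2,\qquad g_n(x)=2x\log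 n-\log \pi_x^a(0)\quad(x\in(0,1)).$$ For $m\ge1$ let $$\varphi_{r,m}(t)=e^{-t\sqrt m/\kappa^a}\Big(1+\frac{t}{\sqrt m}\Big)^{m/\kappa^a}\ (t>0),\qquad \varphi_{l,m}(t)=e^{t\sqrt m/\kappa^a}\Big(1-\frac{t}{\sqrt m}\Big)^{m/\kappa^a}\ (0<t<\sqrt m);$$ these are bijections onto $(0,1)$. For $\beta\in(0,1)$ let $q_{r,m}^a(\beta)$ and $q_{l,m}^a(\beta)$ be the values at $\beta$ of their inverses, and put $x_{l,m}^a(\beta)=1-q_{l,m}^a(\beta)/\sqrt m$, $x_{r,m}^a(\beta)=1+q_{r,m}^a(\beta)/\sqrt m$, and $q^a(\beta)=\sqrt{2\kappa^a\log(1/\beta)}$. Fix $\alpha\in(0,1)$. Then $\kappa^a<\infty$, and the following hold. 1. For every $n\ge \ell+1$, $$\mathbb P\Big(\log x_{l,n-\ell}^a(\alpha/2)-\log S_n^a\le g_n(H)\le \log x_{r,n-\ell}^a(\alpha/2)-\log S_n^a\Big)\ge 1-\alpha .$$ 2. Suppose moreover that $\tau^a\ge 0$. Then $$\Lambda^a:=\sup_{x\in(0,1)}\frac{\sum_{q,r}a_qa_r\log(|q-r|)\,|q-r|^{2x}}{\sum_{q,r}a_qa_r|q-r|^{2x}}<\infty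 .$$ For every $n\ge\ell+1$ with $n\ge e^{\Lambda^a}$, the function $g_n$ is a strictly increasing bijection from $(0,1)$ onto $\big(-\log(\frac12\sum_q a_q^2),\infty\big)$ and $$\mathbb P\Big(H\in\big[\widetilde H_n^{\inf}(\alpha),\widetilde H_n^{\sup}(\alpha)\big]\Big)\ge 1-\alpha,$$ where $$\widetilde H_n^{\inf}(\alpha)=\max\Big(0,g_n^{-1}\big(\log x_{l,n-\ell}^a(\alpha/2)-\log S_n^a\big)\Big),\qquad \widetilde H_n^{\sup}(\alpha)=\min\Big(1,g_n^{-1}\big(\log x_{r,n-\ell}^a(\alpha/2)-\log S_n^a\big)\Big),$$ and $g_n^{-1}(y):=0$ for $y$ below the range of $g_n$. 3. Suppose again that $\tau^a\ge 0$. Then, almost surely, as $n\to\infty$, $\widetilde H_n^{\inf}(\alpha)\to H$ and $\widetilde H_n^{\sup}(\alpha)\to H$ (so the interval shrinks to $\{H\}$), and its length $\mu_n=\widetilde H_n^{\sup}(\alpha)-\widetilde H_n^{\inf}(\alpha)$ satisfies $$\mu_n\sim\frac{2q^a(\alpha/2)}{\sqrt n}\,\frac1{g_n'(H)}\sim\frac{q^a(\alpha/2)}{\sqrt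 n\,\log n}.$$ -/

import Mathlib

open MeasureTheory ProbabilityTheory Set Filter Topology Asymptotics

noncomputable section

namespace HurstCI

/-- `B`, indexed by `ℝ`, is a fractional Brownian motion under `P`, with Hurst parameter `H` and
scaling coefficient `C`: a centered Gaussian process with stationary increments and variance
function `t ↦ C ^ 2 * |t| ^ (2 * H)`. -/
structure IsFBM {Ω : Type*} [MeasurableSpace Ω] (B : ℝ → Ω → ℝ) (H C : ℝ) (P : Measure Ω) :
    Prop where
  gaussian : IsGaussianProcess B P
  centered : ∀ t : ℝ, ∫ ω, B t ω ∂P = 0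
  stationary_increments : ∀ (h : ℝ) (I : Finset ℝ),
    IdentDistrib (fun ω (t : I) => B (t + h) ω - B h ω) (fun ω (t : I) => B t ω - B 0 ω) P P
  variance_eq : ∀ t : ℝ, variance (B t) P = C ^ 2 * |t| ^ (2 * H)

/-- The vector `a` (with `ℓ + 1` real components) is a filter of order `p`. -/
def IsFilterOfOrder {ℓ : ℕ} (a : Fin (ℓ + 1) → ℝ) (p : ℕ) : Prop :=
  (∀ j < p, ∑ q : Fin (ℓ + 1), ((q : ℕ) : ℝ) ^ j * a q = 0) ∧
    ∑ q : Fin (ℓ + 1), ((q : ℕ) : ℝ) ^ p * a q ≠ 0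

/-- The covariance function `π_H^a(j)` of the filtered series (for `C = 1`). -/
def covFun {ℓ : ℕ} (a : Fin (ℓ + 1) → ℝ) (H : ℝ) (j : ℤ) : ℝ :=
  -(1 / 2) * ∑ q : Fin (ℓ + 1), ∑ r : Fin (ℓ + 1),
    a q * a r * |((q : ℕ) : ℝ) - ((r : ℕ) : ℝ) + (j : ℝ)| ^ (2 * H)

/-- The correlation function `ρ_H^a(j)` of the filtered series. -/
def corrFun {ℓ : ℕ} (a : Fin (ℓ + 1) → ℝ) (H : ℝ) (j : ℤ) : ℝ :=
  covFun a H j / covFun a H 0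

/-- The `ℓ¹(ℤ)` norm of the correlation function. -/
def corrNorm {ℓ : ℕ} (a : Fin (ℓ + 1) → ℝ) (H : ℝ) : ℝ :=
  ∑' j : ℤ, |corrFun a H j|

/-- `κ^a`, twice the supremum over `H ∈ (0, 1)` of the `ℓ¹` norm of the correlation function. -/
def kappa {ℓ : ℕ} (a : Fin (ℓ + 1) → ℝ) : ℝ :=
  2 * sSup (corrNorm a '' Ioo 0 1)

/-- `τ^a = ∑ a_q a_r (q - r)² log |q - r|`; the convention `0 * log 0 = 0` holds here since
`Real.log 0 = 0`. -/
def tau {ℓ : ℕ} (a : Fin (ℓ + 1) → ℝ) : ℝ :=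
  ∑ q : Fin (ℓ + 1), ∑ r : Fin (ℓ + 1),
    a q * a r * (((q : ℕ) : ℝ) - ((r : ℕ) : ℝ)) ^ 2 *
      Real.log |((q : ℕ) : ℝ) - ((r : ℕ) : ℝ)|

/-- The quotient whose supremum over `x ∈ (0, 1)` bounds `log n` from below. -/
def logRatio {ℓ : ℕ} (a : Fin (ℓ + 1) → ℝ) (x : ℝ) : ℝ :=
  (∑ q : Fin (ℓ + 1), ∑ r : Fin (ℓ + 1),
    a q * a r * Real.log |((q : ℕ) : ℝ) - ((r : ℕ) : ℝ)| *
      |((q : ℕ) : ℝ) - ((r : ℕ) : ℝ)| ^ (2 * x)) /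
  (∑ q : Fin (ℓ + 1), ∑ r : Fin (ℓ + 1),
    a q * a r * |((q : ℕ) : ℝ) - ((r : ℕ) : ℝ)| ^ (2 * x))

/-- The condition on the sample size. -/
def SampleSizeCond {ℓ : ℕ} (a : Fin (ℓ + 1) → ℝ) (n : ℕ) : Prop :=
  Real.exp (sSup (logRatio a '' Ioo 0 1)) ≤ (n : ℝ)

/-- The filtered series `V^a(i / n) = ∑ a_q B((i - q) / n)`. -/
def filtered {Ω : Type*} (B : ℝ → Ω → ℝ) {ℓ : ℕ} (a : Fin (ℓ + 1) → ℝ) (n i : ℕ) (ω : Ω) : ℝ :=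
  ∑ q : Fin (ℓ + 1), a q * B (((i : ℝ) - ((q : ℕ) : ℝ)) / (n : ℝ)) ω

/-- The statistic `S_n^a`. -/
def statS {Ω : Type*} (B : ℝ → Ω → ℝ) {ℓ : ℕ} (a : Fin (ℓ + 1) → ℝ) (n : ℕ) (ω : Ω) : ℝ :=
  (1 / ((n : ℝ) - (ℓ : ℝ))) * ∑ i ∈ Finset.Ico ℓ n, filtered B a n i ω ^ 2

/-- The right-tail bound `φ_{r,m}(t; κ)`. -/
def phiR (m : ℕ) (κ t : ℝ) : ℝ :=
  Real.exp (-(t * √(m : ℝ) / κ)) * (1 + t / √(m : ℝ)) ^ ((m : ℝ) / κ)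

/-- The left-tail bound `φ_{l,m}(t; κ)`. -/
def phiL (m : ℕ) (κ t : ℝ) : ℝ :=
  (Icc 0 √(m : ℝ)).indicator
    (fun t => Real.exp (t * √(m : ℝ) / κ) * (1 - t / √(m : ℝ)) ^ ((m : ℝ) / κ)) t

/-- `q_{r,m}^a(β)`: the inverse at `β` of the bijection `φ_{r,m}(·; κ^a)` from `(0, ∞)` onto
`(0, 1)`. -/
def quantR {ℓ : ℕ} (a : Fin (ℓ + 1) → ℝ) (m : ℕ) (β : ℝ) : ℝ :=
  Function.invFunOn (phiR m (kappa a)) (Ioi 0) β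

/-- `q_{l,m}^a(β)`: the inverse at `β` of the bijection `φ_{l,m}(·; κ^a)` from `(0, √m)` onto
`(0, 1)`. -/
def quantL {ℓ : ℕ} (a : Fin (ℓ + 1) → ℝ) (m : ℕ) (β : ℝ) : ℝ :=
  Function.invFunOn (phiL m (kappa a)) (Ioo 0 √(m : ℝ)) β

/-- `x_{r,m}^a(β)`. -/
def xR {ℓ : ℕ} (a : Fin (ℓ + 1) → ℝ) (m : ℕ) (β : ℝ) : ℝ := 1 + quantR a m β / √(m : ℝ)

/-- `x_{l,m}^a(β)`. -/
def xL {ℓ : ℕ} (a : Fin (ℓ + 1) → ℝ) (m : ℕ) (β : ℝ) : ℝ := 1 - quantL a m β / √(m : ℝ)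

/-- `q^a(β) = √(2 κ^a log (1 / β))`. -/
def quantLim {ℓ : ℕ} (a : Fin (ℓ + 1) → ℝ) (β : ℝ) : ℝ :=
  √(2 * kappa a * Real.log (1 / β))

/-- `g_n(x) = 2 x log n - log π_x^a(0)`. -/
def gFun {ℓ : ℕ} (a : Fin (ℓ + 1) → ℝ) (n : ℕ) (x : ℝ) : ℝ :=
  2 * x * Real.log n - Real.log (covFun a x 0)

/-- The lower bound `log x_{l,n-ℓ}^a(α / 2) - log S_n^a` for `g_n(H)`. -/
def lowerB {Ω : Type*} (B : ℝ → Ω → ℝ) {ℓ : ℕ} (a : Fin (ℓ + 1) → ℝ) (α : ℝ) (n : ℕ) (ω : Ω) :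
    ℝ :=
  Real.log (xL a (n - ℓ) (α / 2)) - Real.log (statS B a n ω)

/-- The upper bound `log x_{r,n-ℓ}^a(α / 2) - log S_n^a` for `g_n(H)`. -/
def upperB {Ω : Type*} (B : ℝ → Ω → ℝ) {ℓ : ℕ} (a : Fin (ℓ + 1) → ℝ) (α : ℝ) (n : ℕ) (ω : Ω) :
    ℝ :=
  Real.log (xR a (n - ℓ) (α / 2)) - Real.log (statS B a n ω)

open Classical in
/-- The reciprocal function of `g_n : (0, 1) → ℝ`. The range of `g_n` is a half-line
`(c, ∞)`; for `y ≤ c` the value is set to `0`. -/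
def gInv {ℓ : ℕ} (a : Fin (ℓ + 1) → ℝ) (n : ℕ) (y : ℝ) : ℝ :=
  if y ∈ gFun a n '' Ioo 0 1 then Function.invFunOn (gFun a n) (Ioo 0 1) y else 0

/-- The left end of the confidence interval. -/
def hInf {Ω : Type*} (B : ℝ → Ω → ℝ) {ℓ : ℕ} (a : Fin (ℓ + 1) → ℝ) (α : ℝ) (n : ℕ) (ω : Ω) :
    ℝ :=
  max 0 (gInv a n (lowerB B a α n ω))

/-- The right end of the confidence interval. -/
def hSup {Ω : Type*} (B : ℝ → Ω → ℝ) {ℓ : ℕ} (a : Fin (ℓ + 1) → ℝ) (α : ℝ) (n : ℕ) (ω : Ω) :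
    ℝ :=
  min 1 (gInv a n (upperB B a α n ω))

end HurstCI

end

open HurstCI

/-!
The filtered series `V^a(i / n)` is a stationary centered Gaussian sequence: since `∑ a_q = 0`,
its covariance is `n ^ (-2 H) π_H^a(j - i)` (`covariance_filtered`). The proof rests on three
facts.

*Summability of the correlations, uniformly in the Hurst parameter.* The representation
`|t| ^ (2 x) = c⁻¹ ∫₀^∞ (1 - cos (t u)) u ^ (-1 - 2 x) du` writes `π_x^a(j)` as the integral of
`cos (j u)` against a nonnegative, nonzero density, so that `π_x^a(0) > 0` and
`|π_x^a(j)| ≤ π_x^a(0)` for every `x` in `(0, 1)`. The function `x ↦ π_x^a(0)` extends analytically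
(`varFun`), is positive on `[0, 1)` and vanishes at `1` with derivative `-τ^a`. Hence `τ^a ≥ 0`, and
`τ^a ≠ 0` gives `π_x^a(0) ≥ c (1 - x)`. As the filter has order at least two, a Taylor expansion of
order four gives `|π_x^a(j)| ≤ C (1 - x) / j ^ 2` at large lags. The factors `1 - x` cancel in the
correlations, and `κ^a` is finite.

*Tail bounds.* In an eigenbasis of the covariance matrix, `S_n^a` becomes a sum of independent
squares. The eigenvalues have a known sum and are at most `κ^a / 2` times the common variance, since
this number bounds the row sums. By convexity of `μ ↦ -log (1 - 2 θ μ)`, the Laplace transform is at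
most that of a Gamma variable, and optimising the Chernoff bound gives exactly `φ_{r,m}` and
`φ_{l,m}` (`measure_statS_ge_le`, `measure_statS_le_le`). The bracketing of
`g_n(H) = -log E S_n^a` follows; the bounds decay geometrically in `n` at a fixed relative deviation,
so Borel-Cantelli gives `S_n^a / E S_n^a → 1` almost surely.

*Inversion of `g_n`.* Since `g_n' = 2 (log n - logRatio)`, the sample size condition makes `g_n`
nondecreasing, and analyticity makes it strictly increasing. For the asymptotics, only the linear
part `2 x log n` of `g_n` depends on `n`: by strict differentiability of `log π_x^a(0)` at `H`, the
length of the interval is equivalent to `(log x_r - log x_l) / g_n'(H)`, while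
`m (log (1 + t / √m) - t / √m) → -t ^ 2 / 2` yields the convergence of both quantiles to
`q^a(α / 2)`.
-/

namespace HurstCI

/-! ### Quadratic forms of Gaussian vectors -/

section QuadraticForm

open Matrix

open scoped NNReal

lemma integral_exp_mul_sq_gaussianReal (v : ℝ≥0) {θ : ℝ} (h : 2 * θ * v < 1) :
    ∫ x, Real.exp (θ * x ^ 2) ∂gaussianReal 0 v = (1 - 2 * θ * v) ^ (-(1 / 2) : ℝ) := by
  rcases eq_or_ne v 0 with rfl | hv
  · simp [gaussianReal_zero_var]
  have hv' : (0 : ℝ) < v := by positivity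
  have h1 : 0 < 1 - 2 * θ * v := by linarith
  rw [integral_gaussianReal_eq_integral_smul hv]
  have key : ∀ x : ℝ, gaussianPDFReal 0 v x • Real.exp (θ * x ^ 2) =
      (√(2 * Real.pi * v))⁻¹ * Real.exp (-((1 - 2 * θ * v) / (2 * v)) * x ^ 2) := by
    intro x
    rw [gaussianPDFReal_def, smul_eq_mul, mul_assoc, ← Real.exp_add]
    congr 2
    field_simp
    ring
  simp_rw [key]
  rw [integral_const_mul, integral_gaussian, ← Real.sqrt_inv,
    ← Real.sqrt_mul (by positivity), Real.rpow_neg h1.le, ← Real.sqrt_eq_rpow,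
    ← Real.sqrt_inv]
  congr 1
  have := Real.pi_pos
  field_simp

variable {Ω ι : Type*} [MeasurableSpace Ω] {P : Measure Ω} [Fintype ι]

/-- Rotating a centered Gaussian vector by an eigenbasis of its covariance matrix makes the
coordinates independent, which turns its squared norm into a sum of independent squares. -/
lemma mgf_sum_sq_eq [DecidableEq ι] {X : ι → Ω → ℝ} (hX : HasGaussianLaw (fun ω i => X i ω) P)
    (h0 : ∀ i, ∫ ω, X i ω ∂P = 0) {C : Matrix ι ι ℝ} (hC : C.IsHermitian)
    (hcov : ∀ i j, cov[X i, X j; P] = C i j) (hpos : ∀ k, 0 ≤ hC.eigenvalues k) {θ : ℝ}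
    (hθ : ∀ k, 2 * θ * hC.eigenvalues k < 1) :
    mgf (fun ω => ∑ i, X i ω ^ 2) P θ =
      ∏ k, (1 - 2 * θ * hC.eigenvalues k) ^ (-(1 / 2) : ℝ) := by
  have hP : IsProbabilityMeasure P := hX.isProbabilityMeasure
  set U : Matrix ι ι ℝ := (hC.eigenvectorUnitary : Matrix ι ι ℝ) with hU
  have hUU : U * Uᵀ = 1 := by
    have := Unitary.coe_mul_star_self hC.eigenvectorUnitary
    simpa [star_eq_conjTranspose, conjTranspose_eq_transpose_of_trivial] using this
  have hD : Uᵀ * C * U = diagonal hC.eigenvalues := by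
    have := hC.conjStarAlgAut_star_eigenvectorUnitary
    simpa [Unitary.conjStarAlgAut_apply, star_eq_conjTranspose,
      conjTranspose_eq_transpose_of_trivial, Function.comp_def] using this
  let Y : ι → Ω → ℝ := fun k ω => ∑ i, U i k * X i ω
  have hmem : ∀ i, MemLp (X i) 2 P := fun i => (hX.eval i).memLp_two
  have hYG : HasGaussianLaw (fun ω k => Y k ω) P := by
    have := hX.map_fun ((toLin' Uᵀ).toContinuousLinearMap)
    have e : (fun ω k => Y k ω) =
        fun ω => (toLin' Uᵀ).toContinuousLinearMap fun i => X i ω := by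
      ext ω k
      simp [Y, toLin'_apply, mulVec, dotProduct]
    rw [e]
    exact this
  have hYcov : ∀ k l, cov[Y k, Y l; P] = diagonal hC.eigenvalues k l := by
    intro k l
    rw [← hD]
    change cov[fun ω => ∑ i, U i k * X i ω, fun ω => ∑ i, U i l * X i ω; P] = _
    rw [covariance_fun_sum_fun_sum (fun i => (hmem i).const_mul _)
      (fun i => (hmem i).const_mul _)]
    simp_rw [covariance_const_mul_left, covariance_const_mul_right, hcov, mul_apply,
      transpose_apply, Finset.sum_mul]
    rw [Finset.sum_comm]
    exact Finset.sum_congr rfl fun _ _ => Finset.sum_congr rfl fun _ _ => by ring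
  have hind : iIndepFun Y P := hYG.iIndepFun_of_covariance_eq_zero fun i j hij => by
    rw [hYcov, diagonal_apply_ne _ hij]
  have hY0 : ∀ k, ∫ ω, Y k ω ∂P = 0 := by
    intro k
    change ∫ ω, ∑ i, U i k * X i ω ∂P = 0
    rw [integral_finsetSum _ fun i _ => ((hX.eval i).integrable).const_mul _]
    simp [integral_const_mul, h0]
  have hYlaw : ∀ k, P.map (Y k) = gaussianReal 0 (hC.eigenvalues k).toNNReal := by
    intro k
    rw [(hYG.eval k).map_eq_gaussianReal, hY0]
    congr 1
    rw [← covariance_self (hYG.eval k).aemeasurable, hYcov, diagonal_apply_eq]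
  have hsum : (fun ω => ∑ i, X i ω ^ 2) = ∑ k, fun ω => Y k ω ^ 2 := by
    funext ω
    rw [Finset.sum_apply]
    have e1 : ∀ z : ι → ℝ, ∑ i, z i ^ 2 = z ⬝ᵥ z := fun z => by
      simp [dotProduct, sq]
    have e2 : (fun k => Y k ω) = Uᵀ *ᵥ fun i => X i ω := by
      ext k
      simp [Y, mulVec, dotProduct]
    rw [e1, e1 (fun k => Y k ω), e2, dotProduct_mulVec, vecMul_transpose, mulVec_mulVec, hUU,
      one_mulVec]
  rw [hsum, iIndepFun.mgf_sum₀ (X := fun k ω => Y k ω ^ 2)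
    (hind.comp (fun _ x => x ^ 2) fun _ => by fun_prop)
    (fun k => (hYG.eval k).aemeasurable.pow_const 2)]
  refine Finset.prod_congr rfl fun k _ => ?_
  rw [mgf, ← integral_map (f := fun x => Real.exp (θ * x ^ 2)) (hYG.eval k).aemeasurable
    (by fun_prop), hYlaw, integral_exp_mul_sq_gaussianReal _ (by
      rw [Real.coe_toNNReal _ (hpos k)]; exact hθ k), Real.coe_toNNReal _ (hpos k)]

/-- The bound `-log (1 - 2 θ μ) ≤ -(2 μ / L) log (1 - θ L)` for `0 ≤ 2 μ ≤ L`, in exponential form: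
it is the convexity of `μ ↦ -log (1 - 2 θ μ)`. -/
lemma one_sub_rpow_le {θ L μ : ℝ} (hL : 0 < L) (hθ : θ * L < 1) (hμ : 0 ≤ μ) (hμL : 2 * μ ≤ L) :
    0 < 1 - 2 * θ * μ ∧
      (1 - 2 * θ * μ) ^ (-(1 / 2) : ℝ) ≤ (1 - θ * L) ^ (-(μ / L)) := by
  have h1 : 0 < 1 - θ * L := by linarith
  have hw : 2 * μ / L ≤ 1 := by rwa [div_le_one hL]
  have hw0 : 0 ≤ 2 * μ / L := by positivity
  have h2 := rpow_one_add_le_one_add_mul_self (s := -(θ * L)) (by linarith) hw0 hw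
  have h3 : 1 + 2 * μ / L * -(θ * L) = 1 - 2 * θ * μ := by field_simp; ring
  rw [h3, ← sub_eq_add_neg] at h2
  have h4 : 0 < (1 - θ * L) ^ (2 * μ / L) := Real.rpow_pos_of_pos h1 _
  refine ⟨h4.trans_le h2, ?_⟩
  calc (1 - 2 * θ * μ) ^ (-(1 / 2) : ℝ) ≤ ((1 - θ * L) ^ (2 * μ / L)) ^ (-(1 / 2) : ℝ) :=
        Real.rpow_le_rpow_of_nonpos h4 h2 (by norm_num)
    _ = (1 - θ * L) ^ (-(μ / L)) := by
        rw [← Real.rpow_mul h1.le]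
        congr 1
        ring

/-- The squared norm of a centered Gaussian vector whose covariance matrix has absolute row sums at
most `L / 2` has a Laplace transform at most that of a Gamma variable with the same mean and with
scale `L`. -/
lemma mgf_sum_sq_le {X : ι → Ω → ℝ} (hX : HasGaussianLaw (fun ω i => X i ω) P)
    (h0 : ∀ i, ∫ ω, X i ω ∂P = 0) {L θ : ℝ} (hL : 0 < L)
    (hrow : ∀ i, 2 * ∑ j, |cov[X i, X j; P]| ≤ L) (hθ : θ * L < 1) :
    Integrable (fun ω => Real.exp (θ * ∑ i, X i ω ^ 2)) P ∧
      mgf (fun ω => ∑ i, X i ω ^ 2) P θ ≤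
        (1 - θ * L) ^ (-((∑ i, variance (X i) P) / L)) := by
  classical
  have hP : IsProbabilityMeasure P := hX.isProbabilityMeasure
  have hmem : ∀ i, MemLp (X i) 2 P := fun i => (hX.eval i).memLp_two
  let C : Matrix ι ι ℝ := Matrix.of fun i j => cov[X i, X j; P]
  have hcov : ∀ i j, cov[X i, X j; P] = C i j := fun _ _ => rfl
  have hC : C.IsHermitian := by
    ext i j
    simp [C, covariance_comm (X i) (X j)]
  have hpsd : C.PosSemidef := by
    refine PosSemidef.of_dotProduct_mulVec_nonneg hC fun x => ?_
    have : star x ⬝ᵥ C *ᵥ x = variance (fun ω => ∑ i, x i * X i ω) P := by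
      rw [← covariance_self
        (Finset.aemeasurable_fun_sum _ fun i _ => (hX.eval i).aemeasurable.const_mul _),
        covariance_fun_sum_fun_sum (fun i => (hmem i).const_mul _)
        (fun i => (hmem i).const_mul _)]
      simp_rw [covariance_const_mul_left, covariance_const_mul_right, hcov, dotProduct, mulVec,
        dotProduct, Finset.mul_sum, Pi.star_apply, star_trivial]
      exact Finset.sum_congr rfl fun _ _ => Finset.sum_congr rfl fun _ _ => by ring
    rw [this]
    exact variance_nonneg _ _
  have hpos : ∀ k, 0 ≤ hC.eigenvalues k := hpsd.eigenvalues_nonneg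
  have hle : ∀ k, 2 * hC.eigenvalues k ≤ L := by
    intro k
    have hev : Module.End.HasEigenvalue (toLin' C) (hC.eigenvalues k) := by
      refine Module.End.hasEigenvalue_of_hasEigenvector
        (x := (hC.eigenvectorBasis k : ι → ℝ)) ⟨?_, ?_⟩
      · rw [Module.End.mem_eigenspace_iff, toLin'_apply]
        simpa using hC.mulVec_eigenvectorBasis k
      · intro h
        have := hC.eigenvectorBasis.orthonormal.ne_zero k
        exact this (by ext i; simpa using congrFun h i)
    obtain ⟨i, hi⟩ := eigenvalue_mem_ball hev
    rw [Metric.mem_closedBall, Real.dist_eq] at hi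
    have h1 : ∑ j, |C i j| = |C i i| + ∑ j ∈ Finset.univ.erase i, |C i j| :=
      (Finset.add_sum_erase _ _ (Finset.mem_univ i)).symm
    have h2 := hrow i
    simp_rw [hcov] at h2
    simp only [Real.norm_eq_abs] at hi
    linarith [le_abs_self (hC.eigenvalues k - C i i), le_abs_self (C i i)]
  have hb := fun k => one_sub_rpow_le hL hθ (hpos k) (hle k)
  have hmgf := mgf_sum_sq_eq hX h0 hC hcov hpos (θ := θ) fun k => by linarith [(hb k).1]
  have htr : ∑ i, variance (X i) P = ∑ k, hC.eigenvalues k := by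
    have := hC.trace_eq_sum_eigenvalues
    simp only [trace, diag_apply, RCLike.ofReal_real_eq_id, id] at this
    rw [← this]
    exact Finset.sum_congr rfl fun i _ => (covariance_self (hX.eval i).aemeasurable).symm
  constructor
  · by_contra hni
    have : mgf (fun ω => ∑ i, X i ω ^ 2) P θ = 0 := integral_undef hni
    rw [hmgf] at this
    exact (Finset.prod_pos fun k _ => Real.rpow_pos_of_pos (hb k).1 _).ne' this
  · rw [hmgf, htr]
    calc _ ≤ ∏ k, (1 - θ * L) ^ (-(hC.eigenvalues k / L)) :=
          Finset.prod_le_prod (fun k _ => (Real.rpow_pos_of_pos (hb k).1 _).le)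
            fun k _ => (hb k).2
      _ = _ := by
          rw [← Real.rpow_sum_of_pos (by linarith), Finset.sum_neg_distrib, Finset.sum_div]

variable {X : ι → Ω → ℝ} {L T s : ℝ}

lemma measure_sum_sq_ge_le (hX : HasGaussianLaw (fun ω i => X i ω) P)
    (h0 : ∀ i, ∫ ω, X i ω ∂P = 0) (hL : 0 < L) (hrow : ∀ i, 2 * ∑ j, |cov[X i, X j; P]| ≤ L)
    (hT : ∑ i, variance (X i) P = T) (hs : 0 ≤ s) :
    P.real {ω | T * (1 + s) ≤ ∑ i, X i ω ^ 2} ≤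
      Real.exp (-(s * (T / L))) * (1 + s) ^ (T / L) := by
  have hP : IsProbabilityMeasure P := hX.isProbabilityMeasure
  -- the Chernoff exponent is optimal where `1 - θ * L = 1 / (1 + s)`
  have hs1 : 0 < 1 + s := by linarith
  have hθL : 1 - s / ((1 + s) * L) * L = (1 + s)⁻¹ := by field_simp; ring
  obtain ⟨h1, h2⟩ := mgf_sum_sq_le hX h0 hL hrow (θ := s / ((1 + s) * L))
    (by linarith [inv_pos.2 hs1])
  refine (measure_ge_le_exp_mul_mgf _ (by positivity) h1).trans ?_
  rw [hθL, hT, Real.inv_rpow hs1.le, Real.rpow_neg hs1.le, inv_inv] at h2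
  have h3 : -(s / ((1 + s) * L)) * (T * (1 + s)) = -(s * (T / L)) := by field_simp
  rw [h3]
  gcongr

lemma measure_sum_sq_le_le (hX : HasGaussianLaw (fun ω i => X i ω) P)
    (h0 : ∀ i, ∫ ω, X i ω ∂P = 0) (hL : 0 < L) (hrow : ∀ i, 2 * ∑ j, |cov[X i, X j; P]| ≤ L)
    (hT : ∑ i, variance (X i) P = T) (hs : 0 ≤ s) (hs1 : s < 1) :
    P.real {ω | ∑ i, X i ω ^ 2 ≤ T * (1 - s)} ≤
      Real.exp (s * (T / L)) * (1 - s) ^ (T / L) := by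
  have hP : IsProbabilityMeasure P := hX.isProbabilityMeasure
  -- the Chernoff exponent is optimal where `1 - θ * L = 1 / (1 - s)`
  have hs1 : 0 < 1 - s := by linarith
  have hθL : 1 - -(s / ((1 - s) * L)) * L = (1 - s)⁻¹ := by field_simp; ring
  obtain ⟨h1, h2⟩ := mgf_sum_sq_le hX h0 hL hrow (θ := -(s / ((1 - s) * L)))
    (by linarith [inv_pos.2 hs1])
  refine (measure_le_le_exp_mul_mgf _ (by rw [neg_nonpos]; positivity) h1).trans ?_
  rw [hθL, hT, Real.inv_rpow hs1.le, Real.rpow_neg hs1.le, inv_inv] at h2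
  have h3 : - -(s / ((1 - s) * L)) * (T * (1 - s)) = s * (T / L) := by field_simp
  rw [h3]
  gcongr

end QuadraticForm

/-! ### Spectral representation of the covariance function -/

section Spectral

lemma setIntegral_Ioi_pos {f : ℝ → ℝ} (hc : ContinuousOn f (Ioi 0))
    (hi : IntegrableOn f (Ioi 0)) (h0 : ∀ u ∈ Ioi (0 : ℝ), 0 ≤ f u)
    (h1 : ∃ u ∈ Ioi (0 : ℝ), 0 < f u) : 0 < ∫ u in Ioi (0 : ℝ), f u := by
  rw [setIntegral_pos_iff_support_of_nonneg_ae
    ((ae_restrict_iff' measurableSet_Ioi).2 (ae_of_all _ h0)) hi]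
  obtain ⟨u, hu, hfu⟩ := h1
  have hopen : IsOpen (Ioi (0 : ℝ) ∩ f ⁻¹' Ioi 0) :=
    hc.isOpen_inter_preimage isOpen_Ioi isOpen_Ioi
  refine (hopen.measure_pos volume ⟨u, hu, hfu⟩).trans_le (measure_mono ?_)
  exact fun v hv => ⟨(show 0 < f v from hv.2).ne', hv.1⟩

/-- The constant `∫₀^∞ (1 - cos u) u ^ (-1 - 2 x) du` of the Lévy-Khintchine representation of
`|t| ^ (2 * x)`. -/
noncomputable def levyConst (x : ℝ) : ℝ := ∫ u in Ioi (0 : ℝ), (1 - Real.cos u) * u ^ (-1 - 2 * x)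

variable {x : ℝ}

lemma integrableOn_one_sub_cos (hx : x ∈ Ioo (0 : ℝ) 1) (t : ℝ) :
    IntegrableOn (fun u : ℝ => (1 - Real.cos (t * u)) * u ^ (-1 - 2 * x)) (Ioi 0) := by
  have hcont : ContinuousOn (fun u : ℝ => (1 - Real.cos (t * u)) * u ^ (-1 - 2 * x)) (Ioi 0) :=
    (Continuous.continuousOn (by fun_prop)).mul
      (continuousOn_id.rpow_const fun u hu => Or.inl (ne_of_gt hu))
  have hcos : ∀ y : ℝ, 0 ≤ 1 - Real.cos y := fun y => by linarith [Real.cos_le_one y]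
  rw [← Ioc_union_Ioi_eq_Ioi (zero_le_one' ℝ)]
  refine IntegrableOn.union ?_ ?_
  · have h1 : IntegrableOn (fun u : ℝ => t ^ 2 / 2 * u ^ (1 - 2 * x)) (Ioc 0 1) := by
      refine Integrable.const_mul ?_ _
      have := intervalIntegral.intervalIntegrable_rpow' (a := 0) (b := 1) (r := 1 - 2 * x)
        (by linarith [hx.2])
      rwa [intervalIntegrable_iff_integrableOn_Ioc_of_le zero_le_one] at this
    refine Integrable.mono' h1 ((hcont.mono Ioc_subset_Ioi_self).aestronglyMeasurable
      measurableSet_Ioc) ((ae_restrict_iff' measurableSet_Ioc).2 (ae_of_all _ fun u hu => ?_))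
    have hu0 : 0 < u := hu.1
    rw [Real.norm_of_nonneg (mul_nonneg (hcos _) (by positivity))]
    have h2 := Real.one_sub_sq_div_two_le_cos (x := t * u)
    have h3 : u ^ (1 - 2 * x) = u ^ 2 * u ^ (-1 - 2 * x) := by
      rw [← Real.rpow_natCast, ← Real.rpow_add hu0]
      norm_num
      ring_nf
    rw [h3, ← mul_assoc]
    gcongr
    linarith [mul_pow t u 2]
  · have h1 : IntegrableOn (fun u : ℝ => 2 * u ^ (-1 - 2 * x)) (Ioi 1) :=
      (integrableOn_Ioi_rpow_of_lt (by linarith [hx.1]) one_pos).const_mul _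
    refine Integrable.mono' h1 ((hcont.mono (Ioi_subset_Ioi zero_le_one)).aestronglyMeasurable
      measurableSet_Ioi) ((ae_restrict_iff' measurableSet_Ioi).2 (ae_of_all _ fun u hu => ?_))
    have hu0 : 0 < u := zero_lt_one.trans hu
    rw [Real.norm_of_nonneg (mul_nonneg (hcos _) (by positivity))]
    gcongr
    linarith [Real.neg_one_le_cos (t * u)]

lemma levyConst_pos (hx : x ∈ Ioo (0 : ℝ) 1) : 0 < levyConst x := by
  refine setIntegral_Ioi_pos ?_ (by simpa using integrableOn_one_sub_cos hx 1) ?_ ?_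
  · exact (Continuous.continuousOn (by fun_prop)).mul
      (continuousOn_id.rpow_const fun u hu => Or.inl (ne_of_gt hu))
  · intro u hu
    have hu0 : 0 < u := hu
    exact mul_nonneg (by linarith [Real.cos_le_one u]) (by positivity)
  · exact ⟨Real.pi, Real.pi_pos, mul_pos (by norm_num) (Real.rpow_pos_of_pos Real.pi_pos _)⟩

/-- The Lévy-Khintchine representation of `|t| ^ (2 * x)`, by scaling. -/
lemma integral_one_sub_cos (hx : x ∈ Ioo (0 : ℝ) 1) (t : ℝ) :
    ∫ u in Ioi (0 : ℝ), (1 - Real.cos (t * u)) * u ^ (-1 - 2 * x) =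
      |t| ^ (2 * x) * levyConst x := by
  have hx2 : 2 * x ≠ 0 := by linarith [hx.1]
  rcases eq_or_ne t 0 with rfl | ht
  · simp [Real.zero_rpow hx2]
  have ht' : 0 < |t| := abs_pos.2 ht
  have h1 := integral_comp_mul_left_Ioi
    (fun u : ℝ => (1 - Real.cos u) * u ^ (-1 - 2 * x)) 0 ht'
  rw [mul_zero, smul_eq_mul] at h1
  have h2 : ∫ u in Ioi (0 : ℝ), (1 - Real.cos (|t| * u)) * (|t| * u) ^ (-1 - 2 * x) =
      |t| ^ (-1 - 2 * x) *
        ∫ u in Ioi (0 : ℝ), (1 - Real.cos (t * u)) * u ^ (-1 - 2 * x) := by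
    rw [← integral_const_mul]
    refine setIntegral_congr_fun measurableSet_Ioi fun u hu => ?_
    have hu0 : 0 < u := hu
    have hc : Real.cos (|t| * u) = Real.cos (t * u) := by
      rcases abs_choice t with h | h <;> rw [h]
      rw [neg_mul, Real.cos_neg]
    simp only [hc, Real.mul_rpow ht'.le hu0.le]
    ring
  rw [h2] at h1
  have h3 : |t| ^ (-1 - 2 * x) * |t| ^ (2 * x) = |t|⁻¹ := by
    rw [← Real.rpow_add ht', ← Real.rpow_neg_one]
    congr 1
    ring
  have h4 : |t| ^ (-1 - 2 * x) ≠ 0 := (Real.rpow_pos_of_pos ht' _).ne'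
  apply mul_left_cancel₀ h4
  rw [h1, ← mul_assoc, h3, levyConst]

variable {ℓ : ℕ} {a : Fin (ℓ + 1) → ℝ}

/-- The squared modulus `|∑ a_q e^{i q u}| ^ 2` of the transfer function of the filter. -/
noncomputable def transferSq (a : Fin (ℓ + 1) → ℝ) (u : ℝ) : ℝ :=
  (∑ q : Fin (ℓ + 1), a q * Real.cos (((q : ℕ) : ℝ) * u)) ^ 2 +
    (∑ q : Fin (ℓ + 1), a q * Real.sin (((q : ℕ) : ℝ) * u)) ^ 2

lemma sum_sum_cos (a : Fin (ℓ + 1) → ℝ) (y u : ℝ) :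
    ∑ q : Fin (ℓ + 1), ∑ r : Fin (ℓ + 1),
      a q * a r * Real.cos ((((q : ℕ) : ℝ) - ((r : ℕ) : ℝ) + y) * u) =
    transferSq a u * Real.cos (y * u) := by
  have h : ∀ q r : Fin (ℓ + 1),
      a q * a r * Real.cos ((((q : ℕ) : ℝ) - ((r : ℕ) : ℝ) + y) * u) =
      ((a q * Real.cos ((q : ℕ) * u)) * (a r * Real.cos ((r : ℕ) * u)) +
        (a q * Real.sin ((q : ℕ) * u)) * (a r * Real.sin ((r : ℕ) * u))) * Real.cos (y * u) -
      ((a q * Real.sin ((q : ℕ) * u)) * (a r * Real.cos ((r : ℕ) * u)) -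
        (a q * Real.cos ((q : ℕ) * u)) * (a r * Real.sin ((r : ℕ) * u))) * Real.sin (y * u) := by
    intro q r
    rw [add_mul, sub_mul, Real.cos_add, Real.cos_sub, Real.sin_sub]
    ring
  simp_rw [h, Finset.sum_sub_distrib, ← Finset.sum_mul, Finset.sum_sub_distrib,
    Finset.sum_add_distrib, ← Finset.mul_sum, ← Finset.sum_mul, transferSq]
  ring

lemma integrand_eq (h0 : ∑ q, a q = 0) (y u w : ℝ) :
    -(1 / 2) * ∑ q : Fin (ℓ + 1), ∑ r : Fin (ℓ + 1),
      a q * a r * ((1 - Real.cos ((((q : ℕ) : ℝ) - ((r : ℕ) : ℝ) + y) * u)) * w) =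
    1 / 2 * transferSq a u * Real.cos (y * u) * w := by
  simp_rw [← mul_assoc, mul_sub, sub_mul, mul_one, Finset.sum_sub_distrib, ← Finset.sum_mul,
    ← Finset.mul_sum, h0, sum_sum_cos]
  simp only [mul_zero, Finset.sum_const_zero, zero_mul]
  ring

lemma integrableOn_transferSq (h0 : ∑ q, a q = 0) (hx : x ∈ Ioo (0 : ℝ) 1) (y : ℝ) :
    IntegrableOn (fun u : ℝ => 1 / 2 * transferSq a u * Real.cos (y * u) * u ^ (-1 - 2 * x))
      (Ioi 0) := by
  simp_rw [← integrand_eq h0]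
  refine Integrable.const_mul (integrable_finsetSum _ fun q _ => integrable_finsetSum _
    fun r _ => Integrable.const_mul (integrableOn_one_sub_cos hx _) _) _

lemma covFun_mul_levyConst (h0 : ∑ q, a q = 0) (hx : x ∈ Ioo (0 : ℝ) 1) (j : ℤ) :
    covFun a x j * levyConst x =
      ∫ u in Ioi (0 : ℝ), 1 / 2 * transferSq a u * Real.cos (j * u) * u ^ (-1 - 2 * x) := by
  have hint : ∀ q r : Fin (ℓ + 1), IntegrableOn (fun u : ℝ => a q * a r *
      ((1 - Real.cos ((((q : ℕ) : ℝ) - ((r : ℕ) : ℝ) + j) * u)) * u ^ (-1 - 2 * x))) (Ioi 0) :=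
    fun q r => Integrable.const_mul (integrableOn_one_sub_cos hx _) _
  simp_rw [← integrand_eq h0]
  rw [integral_const_mul, integral_finsetSum _ fun q _ => integrable_finsetSum _
    fun r _ => hint q r]
  simp_rw [integral_finsetSum _ fun r _ => hint _ r, integral_const_mul,
    integral_one_sub_cos hx]
  rw [covFun, mul_assoc, Finset.sum_mul]
  simp_rw [Finset.sum_mul, mul_assoc]

lemma transferSq_nonneg (a : Fin (ℓ + 1) → ℝ) (u : ℝ) : 0 ≤ transferSq a u := by
  unfold transferSq
  positivity

lemma continuous_transferSq (a : Fin (ℓ + 1) → ℝ) : Continuous (transferSq a) := by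
  unfold transferSq
  fun_prop

/-- The transfer function of a nonzero filter does not vanish identically: it is a polynomial in
`e^{i u}`. -/
lemma exists_transferSq_pos (ha : a ≠ 0) : ∃ u ∈ Ioi (0 : ℝ), 0 < transferSq a u := by
  by_contra! hcon
  apply ha
  let Q : Polynomial ℂ := ∑ q : Fin (ℓ + 1), Polynomial.monomial (q : ℕ) (a q : ℂ)
  have hroot : ∀ u ∈ Ioo (0 : ℝ) 1, Q.IsRoot (Complex.exp (u * Complex.I)) := by
    intro u hu
    have h1 := le_antisymm (hcon u hu.1) (transferSq_nonneg a u)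
    unfold transferSq at h1
    have h2 : ∑ q : Fin (ℓ + 1), a q * Real.cos (((q : ℕ) : ℝ) * u) = 0 := by nlinarith
    have h3 : ∑ q : Fin (ℓ + 1), a q * Real.sin (((q : ℕ) : ℝ) * u) = 0 := by nlinarith
    rw [Polynomial.IsRoot, Polynomial.eval_finsetSum]
    have h4 : ∀ q : Fin (ℓ + 1),
        (Polynomial.monomial (q : ℕ) (a q : ℂ)).eval (Complex.exp (u * Complex.I)) =
        ((a q * Real.cos (((q : ℕ) : ℝ) * u) : ℝ) : ℂ) +
          ((a q * Real.sin (((q : ℕ) : ℝ) * u) : ℝ) : ℂ) * Complex.I := by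
      intro q
      rw [Polynomial.eval_monomial, ← Complex.exp_nat_mul, ← mul_assoc, Complex.exp_mul_I]
      push_cast
      ring
    simp_rw [h4]
    rw [Finset.sum_add_distrib, ← Finset.sum_mul, ← Complex.ofReal_sum, ← Complex.ofReal_sum,
      h2, h3]
    simp
  have hinf : Set.Infinite {z | Q.IsRoot z} := by
    refine Set.Infinite.mono (s := (fun u : ℝ => Complex.exp (u * Complex.I)) '' Ioo 0 1) ?_ ?_
    · rintro _ ⟨u, hu, rfl⟩
      exact hroot u hu
    · refine (Ioo_infinite zero_lt_one).image fun u hu v hv huv => ?_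
      have h5 := congrArg Complex.re huv
      simp only [Complex.exp_ofReal_mul_I_re] at h5
      have hpi := Real.pi_gt_three
      exact Real.injOn_cos ⟨hu.1.le, by linarith [hu.2]⟩ ⟨hv.1.le, by linarith [hv.2]⟩ h5
  have hQ : Q = 0 := Polynomial.eq_zero_of_infinite_isRoot Q hinf
  ext q
  have h6 : Q.coeff q = 0 := by rw [hQ, Polynomial.coeff_zero]
  simp only [Q, Polynomial.finsetSum_coeff, Polynomial.coeff_monomial, Fin.val_inj,
    Finset.sum_ite_eq', Finset.mem_univ, if_true] at h6
  exact_mod_cast h6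

lemma covFun_zero_pos (ha : a ≠ 0) (h0 : ∑ q, a q = 0) (hx : x ∈ Ioo (0 : ℝ) 1) :
    0 < covFun a x 0 := by
  have h1 := covFun_mul_levyConst h0 hx 0
  have h2 : 0 < covFun a x 0 * levyConst x := by
    rw [h1]
    refine setIntegral_Ioi_pos ?_ (by exact_mod_cast integrableOn_transferSq h0 hx 0) ?_ ?_
    · exact (Continuous.continuousOn (by have := continuous_transferSq a; fun_prop)).mul
        (continuousOn_id.rpow_const fun u hu => Or.inl (ne_of_gt hu))
    · intro u hu
      have hu0 : 0 < u := hu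
      have := transferSq_nonneg a u
      simp only [Int.cast_zero, zero_mul, Real.cos_zero]
      positivity
    · obtain ⟨u, hu, hpos⟩ := exists_transferSq_pos ha
      have hu0 : 0 < u := hu
      refine ⟨u, hu, ?_⟩
      simp only [Int.cast_zero, zero_mul, Real.cos_zero]
      positivity
  exact pos_of_mul_pos_left h2 (levyConst_pos hx).le

lemma abs_covFun_le (h0 : ∑ q, a q = 0) (hx : x ∈ Ioo (0 : ℝ) 1) (j : ℤ) :
    |covFun a x j| ≤ covFun a x 0 := by
  have hc := levyConst_pos hx
  refine le_of_mul_le_mul_right ?_ hc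
  rw [← abs_of_pos hc, ← abs_mul, abs_of_pos hc, covFun_mul_levyConst h0 hx,
    covFun_mul_levyConst h0 hx]
  refine (abs_integral_le_integral_abs).trans ?_
  refine setIntegral_mono_on (integrableOn_transferSq h0 hx j).abs
    (by exact_mod_cast integrableOn_transferSq h0 hx 0) measurableSet_Ioi fun u hu => ?_
  have hu0 : 0 < u := hu
  have h1 := transferSq_nonneg a u
  have h2 : 0 ≤ u ^ (-1 - 2 * x) := by positivity
  rw [abs_mul, abs_mul, abs_of_nonneg h2, abs_of_nonneg (by positivity : 0 ≤ 1/2 * transferSq a u)]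
  simp only [Int.cast_zero, zero_mul, Real.cos_zero]
  gcongr
  exact Real.abs_cos_le_one _

end Spectral

/-! ### Decay of the correlations and finiteness of `kappa` -/

section Kappa

variable {ℓ : ℕ} {a : Fin (ℓ + 1) → ℝ} {p : ℕ} {x : ℝ}

lemma IsFilterOfOrder.sum_eq_zero (ha : IsFilterOfOrder a p) (hp : 2 ≤ p) : ∑ q, a q = 0 := by
  simpa using ha.1 0 (by omega)

lemma IsFilterOfOrder.sum_mul_eq_zero (ha : IsFilterOfOrder a p) (hp : 2 ≤ p) :
    ∑ q : Fin (ℓ + 1), ((q : ℕ) : ℝ) * a q = 0 := by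
  simpa using ha.1 1 (by omega)

lemma IsFilterOfOrder.ne_zero (ha : IsFilterOfOrder a p) : a ≠ 0 := by
  rintro rfl
  exact ha.2 (by simp)

/-- The autocorrelation of a filter of order at least two annihilates cubic polynomials. -/
lemma sum_sum_sub_pow (h0 : ∑ q, a q = 0) (h1 : ∑ q : Fin (ℓ + 1), ((q : ℕ) : ℝ) * a q = 0)
    {k : ℕ} (hk : k < 4) :
    ∑ q : Fin (ℓ + 1), ∑ r : Fin (ℓ + 1),
      a q * a r * (((q : ℕ) : ℝ) - ((r : ℕ) : ℝ)) ^ k = 0 := by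
  have key : ∀ q r : Fin (ℓ + 1), a q * a r * (((q : ℕ) : ℝ) - ((r : ℕ) : ℝ)) ^ k =
      ∑ m ∈ Finset.range (k + 1), (((q : ℕ) : ℝ) ^ m * a q) *
        ((((r : ℕ) : ℝ) ^ (k - m) * a r) * ((-1) ^ (k - m) * (k.choose m : ℝ))) := by
    intro q r
    rw [sub_eq_add_neg, add_pow, Finset.mul_sum]
    refine Finset.sum_congr rfl fun m _ => ?_
    rw [neg_pow]
    ring
  simp_rw [key]
  simp_rw [Finset.sum_comm (s := Finset.univ) (t := Finset.range (k + 1)), ← Finset.mul_sum,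
    ← Finset.sum_mul]
  have hM : ∀ m : ℕ, m < 2 → ∑ q : Fin (ℓ + 1), ((q : ℕ) : ℝ) ^ m * a q = 0 := by
    intro m hm
    interval_cases m
    · simpa using h0
    · simpa using h1
  refine Finset.sum_eq_zero fun m _ => ?_
  rcases lt_or_ge m 2 with hm | hm
  · rw [hM m hm, zero_mul]
  · rw [hM (k - m) (by omega), zero_mul, mul_zero]

lemma covFun_neg (a : Fin (ℓ + 1) → ℝ) (x : ℝ) (j : ℤ) : covFun a x (-j) = covFun a x j := by
  unfold covFun
  rw [Finset.sum_comm]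
  congr 1
  refine Finset.sum_congr rfl fun q _ => Finset.sum_congr rfl fun r _ => ?_
  rw [mul_comm (a r), ← abs_neg]
  congr 3
  push_cast
  ring

/-- A function on `[0, 1]` that vanishes at `0` is bounded by any bound of its derivative. -/
lemma abs_le_of_deriv_bound {g g' : ℝ → ℝ} {M : ℝ}
    (hg : ∀ s ∈ Icc (0 : ℝ) 1, HasDerivAt g (g' s) s) (h0 : g 0 = 0)
    (hb : ∀ s ∈ Icc (0 : ℝ) 1, |g' s| ≤ M) : ∀ s ∈ Icc (0 : ℝ) 1, |g s| ≤ M := by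
  intro s hs
  have h1 := (convex_Icc (0 : ℝ) 1).norm_image_sub_le_of_norm_hasDerivWithin_le
    (fun s hs => (hg s hs).hasDerivWithinAt) hb (left_mem_Icc.2 zero_le_one) hs
  have hM : 0 ≤ M := (abs_nonneg _).trans (hb 0 (left_mem_Icc.2 zero_le_one))
  rw [h0, sub_zero, sub_zero, Real.norm_eq_abs, Real.norm_eq_abs, abs_of_nonneg hs.1] at h1
  nlinarith [hs.2]

/-- Taylor expansion of order four of `t ↦ t ^ (2 * x)` around `j`: the polynomial part is
annihilated by the filter, and the factor `1 - x` comes from the fourth derivative. -/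
lemma exists_abs_covFun_le_of_large (h0 : ∑ q, a q = 0)
    (h1 : ∑ q : Fin (ℓ + 1), ((q : ℕ) : ℝ) * a q = 0) :
    ∃ C : ℝ, 0 ≤ C ∧ ∀ x ∈ Ioo (0 : ℝ) 1, ∀ j : ℤ, 2 * ((ℓ : ℤ) + 1) ≤ |j| →
      |covFun a x j| ≤ C * (1 - x) * (1 / (j : ℝ) ^ 2) := by
  let A : ℝ := ∑ q : Fin (ℓ + 1), ∑ r : Fin (ℓ + 1),
    |a q| * |a r| * |((q : ℕ) : ℝ) - ((r : ℕ) : ℝ)| ^ 4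
  have hA : 0 ≤ A := by positivity
  refine ⟨48 * A, by positivity, fun x hx j hj => ?_⟩
  wlog hj0 : 0 ≤ j generalizing j
  · have := this (-j) (by rwa [abs_neg]) (by omega)
    rw [covFun_neg] at this
    simpa using this
  rw [abs_of_nonneg hj0] at hj
  have hjR : 2 * ((ℓ : ℝ) + 1) ≤ (j : ℝ) := by exact_mod_cast hj
  have hℓ : (0 : ℝ) ≤ ℓ := Nat.cast_nonneg _
  have hd : ∀ q r : Fin (ℓ + 1), |((q : ℕ) : ℝ) - ((r : ℕ) : ℝ)| ≤ ℓ := by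
    intro q r
    have hq : ((q : ℕ) : ℝ) ≤ ℓ := by exact_mod_cast Nat.lt_succ_iff.1 q.2
    have hr : ((r : ℕ) : ℝ) ≤ ℓ := by exact_mod_cast Nat.lt_succ_iff.1 r.2
    have hq0 : (0 : ℝ) ≤ ((q : ℕ) : ℝ) := Nat.cast_nonneg _
    have hr0 : (0 : ℝ) ≤ ((r : ℕ) : ℝ) := Nat.cast_nonneg _
    rw [abs_le]
    constructor <;> linarith
  have hbase : ∀ q r : Fin (ℓ + 1), ∀ s ∈ Icc (0 : ℝ) 1,
      (j : ℝ) / 2 ≤ j + s * (((q : ℕ) : ℝ) - ((r : ℕ) : ℝ)) := by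
    intro q r s hs
    have h2 := abs_le.1 (hd q r)
    nlinarith [hs.1, hs.2]
  let c : ℕ → ℝ := fun k => ∏ i ∈ Finset.range k, (2 * x - i)
  let G : ℕ → ℝ → ℝ := fun k s => ∑ q : Fin (ℓ + 1), ∑ r : Fin (ℓ + 1),
    a q * a r * (((q : ℕ) : ℝ) - ((r : ℕ) : ℝ)) ^ k *
      (c k * (j + s * (((q : ℕ) : ℝ) - ((r : ℕ) : ℝ))) ^ (2 * x - k))
  have hGd : ∀ k, ∀ s ∈ Icc (0 : ℝ) 1, HasDerivAt (G k) (G (k + 1) s) s := by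
    intro k s hs
    refine HasDerivAt.fun_sum fun q _ => HasDerivAt.fun_sum fun r _ => ?_
    have hb := hbase q r s hs
    have h2 : HasDerivAt (fun s : ℝ => (j : ℝ) + s * (((q : ℕ) : ℝ) - ((r : ℕ) : ℝ)))
        (((q : ℕ) : ℝ) - ((r : ℕ) : ℝ)) s := by
      simpa using ((hasDerivAt_id s).mul_const (((q : ℕ) : ℝ) - ((r : ℕ) : ℝ))).const_add (j : ℝ)
    have h3 := ((h2.rpow_const (p := 2 * x - k) (Or.inl (by linarith))).const_mul (c k)).const_mul
      (a q * a r * (((q : ℕ) : ℝ) - ((r : ℕ) : ℝ)) ^ k)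
    refine h3.congr_deriv ?_
    simp only [c, Finset.prod_range_succ]
    push_cast
    rw [show 2 * x - ((k : ℝ) + 1) = 2 * x - k - 1 by ring]
    ring
  have hG0 : ∀ k, k < 4 → G k 0 = 0 := by
    intro k hk
    simp only [G, zero_mul, add_zero, ← Finset.sum_mul]
    rw [sum_sum_sub_pow h0 h1 hk, zero_mul]
  have hc4 : |c 4| ≤ 12 * (1 - x) := by
    have : c 4 = (2 * x) * (2 * x - 1) * (3 - 2 * x) * (2 * (1 - x)) := by
      simp only [c, Finset.prod_range_succ, Finset.prod_range_zero]
      push_cast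
      ring
    rw [this, abs_mul, abs_of_nonneg (show 0 ≤ 2 * (1 - x) by linarith [hx.2]), abs_mul, abs_mul]
    have e1 : |2 * x| ≤ 2 := abs_le.2 ⟨by linarith [hx.1], by linarith [hx.2]⟩
    have e2 : |2 * x - 1| ≤ 1 := abs_le.2 ⟨by linarith [hx.1], by linarith [hx.2]⟩
    have e3 : |3 - 2 * x| ≤ 3 := abs_le.2 ⟨by linarith [hx.2], by linarith [hx.1]⟩
    calc |2 * x| * |2 * x - 1| * |3 - 2 * x| * (2 * (1 - x))
        ≤ 2 * 1 * 3 * (2 * (1 - x)) := by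
          have := hx.2
          gcongr
      _ = 12 * (1 - x) := by ring
  have hM4 : ∀ s ∈ Icc (0 : ℝ) 1, |G 4 s| ≤ 48 * A * (1 - x) * (1 / (j : ℝ) ^ 2) := by
    intro s hs
    calc |G 4 s| ≤ ∑ q : Fin (ℓ + 1), ∑ r : Fin (ℓ + 1),
          |a q| * |a r| * |((q : ℕ) : ℝ) - ((r : ℕ) : ℝ)| ^ 4 *
            (12 * (1 - x) * (4 * (1 / (j : ℝ) ^ 2))) := by
          refine (Finset.abs_sum_le_sum_abs _ _).trans (Finset.sum_le_sum fun q _ =>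
            (Finset.abs_sum_le_sum_abs _ _).trans (Finset.sum_le_sum fun r _ => ?_))
          have hb := hbase q r s hs
          have hb1 : (1 : ℝ) ≤ j / 2 := by linarith
          rw [abs_mul, abs_mul, abs_mul, abs_pow, abs_mul (c 4)]
          refine mul_le_mul_of_nonneg_left (mul_le_mul hc4 ?_ (abs_nonneg _)
            (by linarith [hx.2])) (by positivity)
          rw [abs_of_nonneg (Real.rpow_nonneg (by linarith) _)]
          calc (j + s * (((q : ℕ) : ℝ) - ((r : ℕ) : ℝ))) ^ (2 * x - (4 : ℕ))
              ≤ ((j : ℝ) / 2) ^ (2 * x - (4 : ℕ)) :=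
                Real.rpow_le_rpow_of_nonpos (by linarith) hb (by push_cast; linarith [hx.2])
            _ ≤ ((j : ℝ) / 2) ^ (-2 : ℝ) :=
                Real.rpow_le_rpow_of_exponent_le hb1 (by push_cast; linarith [hx.2])
            _ = 4 * (1 / (j : ℝ) ^ 2) := by
                rw [Real.rpow_neg (by linarith), Real.rpow_two, div_pow, inv_div]
                ring
      _ = 48 * A * (1 - x) * (1 / (j : ℝ) ^ 2) := by
          simp_rw [← Finset.sum_mul]
          simp only [A]
          ring
  have hM3 := abs_le_of_deriv_bound (hGd 3) (hG0 3 (by norm_num)) hM4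
  have hM2 := abs_le_of_deriv_bound (hGd 2) (hG0 2 (by norm_num)) hM3
  have hM1 := abs_le_of_deriv_bound (hGd 1) (hG0 1 (by norm_num)) hM2
  have hM0 := abs_le_of_deriv_bound (hGd 0) (hG0 0 (by norm_num)) hM1 1
    (right_mem_Icc.2 zero_le_one)
  have hG : covFun a x j = -(1 / 2) * G 0 1 := by
    unfold covFun
    congr 1
    refine Finset.sum_congr rfl fun q _ => Finset.sum_congr rfl fun r _ => ?_
    have hb := hbase q r 1 (right_mem_Icc.2 zero_le_one)
    rw [abs_of_nonneg (by linarith)]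
    simp only [c, Finset.range_zero, Finset.prod_empty, pow_zero, mul_one, one_mul,
      Nat.cast_zero, sub_zero]
    rw [add_comm]
  rw [hG, abs_mul]
  have : |(-(1 / 2) : ℝ)| ≤ 1 := by norm_num
  nlinarith [abs_nonneg (G 0 1)]

/-- The analytic continuation `x ↦ -(1/2) ∑_{q ≠ r} a_q a_r |q - r| ^ (2 * x)` of the variance
function `covFun a x 0`. The two differ at `x = 0` only, where the diagonal terms `0 ^ 0 = 1` enter
`covFun`. -/
noncomputable def varFun (a : Fin (ℓ + 1) → ℝ) (x : ℝ) : ℝ :=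
  -(1 / 2) * ∑ q : Fin (ℓ + 1), ∑ r : Fin (ℓ + 1), if q = r then 0 else
    a q * a r * Real.exp (2 * x * Real.log |((q : ℕ) : ℝ) - ((r : ℕ) : ℝ)|)

/-- The derivative of `varFun a`. The diagonal terms vanish since `Real.log 0 = 0`. -/
noncomputable def varFunDeriv (a : Fin (ℓ + 1) → ℝ) (x : ℝ) : ℝ :=
  -∑ q : Fin (ℓ + 1), ∑ r : Fin (ℓ + 1), a q * a r *
    Real.log |((q : ℕ) : ℝ) - ((r : ℕ) : ℝ)| * |((q : ℕ) : ℝ) - ((r : ℕ) : ℝ)| ^ (2 * x)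

lemma abs_sub_pos_of_ne {q r : Fin (ℓ + 1)} (h : q ≠ r) :
    0 < |((q : ℕ) : ℝ) - ((r : ℕ) : ℝ)| := by
  rw [abs_pos, sub_ne_zero]
  exact_mod_cast fun h' => h (Fin.ext h')

lemma varFun_eq (a : Fin (ℓ + 1) → ℝ) (hx : x ≠ 0) : varFun a x = covFun a x 0 := by
  unfold varFun covFun
  congr 1
  refine Finset.sum_congr rfl fun q _ => Finset.sum_congr rfl fun r _ => ?_
  split_ifs with h
  · subst h
    simp [Real.zero_rpow (mul_ne_zero two_ne_zero hx)]
  · rw [Int.cast_zero, add_zero, Real.rpow_def_of_pos (abs_sub_pos_of_ne h), mul_comm (Real.log _)]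

lemma varFun_zero (h0 : ∑ q, a q = 0) : varFun a 0 = (∑ q, a q ^ 2) / 2 := by
  have h1 : ∀ q r : Fin (ℓ + 1), (if q = r then 0 else
      a q * a r * Real.exp (2 * 0 * Real.log |((q : ℕ) : ℝ) - ((r : ℕ) : ℝ)|)) =
      a q * a r - if q = r then a q ^ 2 else 0 := by
    intro q r
    split_ifs with h
    · rw [h]; ring
    · simp
  unfold varFun
  simp_rw [h1, Finset.sum_sub_distrib, ← Finset.mul_sum, h0]
  simp
  ring

lemma varFun_one (h0 : ∑ q, a q = 0) (h1 : ∑ q : Fin (ℓ + 1), ((q : ℕ) : ℝ) * a q = 0) :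
    varFun a 1 = 0 := by
  rw [varFun_eq a one_ne_zero, covFun]
  have h2 := sum_sum_sub_pow h0 h1 (k := 2) (by norm_num)
  simp only [Int.cast_zero, add_zero, mul_one, Real.rpow_ofNat, sq_abs]
  rw [h2, mul_zero]

lemma hasDerivAt_varFun (a : Fin (ℓ + 1) → ℝ) (x : ℝ) :
    HasDerivAt (varFun a) (varFunDeriv a x) x := by
  have h : varFunDeriv a x = -(1 / 2) * ∑ q : Fin (ℓ + 1), ∑ r : Fin (ℓ + 1),
      if q = r then 0 else a q * a r *
        (Real.exp (2 * x * Real.log |((q : ℕ) : ℝ) - ((r : ℕ) : ℝ)|) *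
          (2 * Real.log |((q : ℕ) : ℝ) - ((r : ℕ) : ℝ)|)) := by
    unfold varFunDeriv
    simp_rw [Finset.mul_sum, ← Finset.sum_neg_distrib]
    refine Finset.sum_congr rfl fun q _ => Finset.sum_congr rfl fun r _ => ?_
    split_ifs with h
    · simp [h]
    · rw [Real.rpow_def_of_pos (abs_sub_pos_of_ne h)]
      ring_nf
  rw [h]
  refine HasDerivAt.const_mul _ (HasDerivAt.fun_sum fun q _ => HasDerivAt.fun_sum fun r _ => ?_)
  split_ifs with h
  · exact hasDerivAt_const _ _
  · refine HasDerivAt.const_mul _ (HasDerivAt.exp ?_)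
    simpa using ((hasDerivAt_id x).const_mul 2).mul_const
      (Real.log |((q : ℕ) : ℝ) - ((r : ℕ) : ℝ)|)

lemma varFunDeriv_one (a : Fin (ℓ + 1) → ℝ) : varFunDeriv a 1 = -tau a := by
  unfold varFunDeriv tau
  congr 1
  refine Finset.sum_congr rfl fun q _ => Finset.sum_congr rfl fun r _ => ?_
  rw [mul_one, Real.rpow_ofNat, sq_abs]
  ring

lemma varFun_pos (ha : a ≠ 0) (h0 : ∑ q, a q = 0) (hx : x ∈ Ico (0 : ℝ) 1) : 0 < varFun a x := by
  rcases hx.1.eq_or_lt with h | h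
  · rw [← h, varFun_zero h0]
    obtain ⟨q, hq⟩ := Function.ne_iff.1 ha
    have : 0 < ∑ q, a q ^ 2 :=
      Finset.sum_pos' (fun _ _ => sq_nonneg _) ⟨q, Finset.mem_univ q, by
        exact (sq_nonneg _).lt_of_ne' (pow_ne_zero 2 hq)⟩
    positivity
  · rw [varFun_eq a h.ne']
    exact covFun_zero_pos ha h0 ⟨h, hx.2⟩

/-- `tau a` is minus the left derivative at `1` of the nonnegative function `varFun a`, which
vanishes there. -/
lemma tau_nonneg (ha : a ≠ 0) (h0 : ∑ q, a q = 0)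
    (h1 : ∑ q : Fin (ℓ + 1), ((q : ℕ) : ℝ) * a q = 0) : 0 ≤ tau a := by
  have hd := hasDerivAt_varFun a 1
  rw [varFunDeriv_one] at hd
  have ht := (hasDerivAt_iff_tendsto_slope.1 hd).mono_left
    (nhdsWithin_mono 1 (show Iio (1 : ℝ) ⊆ {1}ᶜ from fun y hy => (show y < 1 from hy).ne))
  have h2 : -tau a ≤ 0 := by
    refine le_of_tendsto ht ?_
    filter_upwards [Ioo_mem_nhdsLT (zero_lt_one' ℝ)] with y hy
    rw [slope_def_field, varFun_one h0 h1, sub_zero]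
    exact div_nonpos_of_nonneg_of_nonpos (varFun_pos ha h0 ⟨hy.1.le, hy.2⟩).le
      (by linarith [hy.2])
  linarith

lemma exists_le_covFun_zero (ha : a ≠ 0) (h0 : ∑ q, a q = 0)
    (h1 : ∑ q : Fin (ℓ + 1), ((q : ℕ) : ℝ) * a q = 0) (hτ : tau a ≠ 0) :
    ∃ c : ℝ, 0 < c ∧ ∀ x ∈ Ioo (0 : ℝ) 1, c * (1 - x) ≤ covFun a x 0 := by
  have hτ' : 0 < tau a := lt_of_le_of_ne (tau_nonneg ha h0 h1) hτ.symm
  have hcont : ContinuousOn (dslope (varFun a) 1) (Icc 0 1) := by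
    intro y _
    rcases eq_or_ne y 1 with rfl | hy
    · exact (continuousAt_dslope_same.2
        (hasDerivAt_varFun a 1).differentiableAt).continuousWithinAt
    · exact ((continuousAt_dslope_of_ne hy).2
        (hasDerivAt_varFun a y).continuousAt).continuousWithinAt
  obtain ⟨y, hy, hmax⟩ := isCompact_Icc.exists_isMaxOn (nonempty_Icc.2 zero_le_one) hcont
  have hneg : dslope (varFun a) 1 y < 0 := by
    rcases eq_or_ne y 1 with rfl | hy1
    · rw [dslope_same, (hasDerivAt_varFun a 1).deriv, varFunDeriv_one]
      linarith
    · have hlt : y < 1 := lt_of_le_of_ne hy.2 hy1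
      rw [dslope_of_ne _ hy1, slope_def_field, varFun_one h0 h1, sub_zero]
      exact div_neg_of_pos_of_neg (varFun_pos ha h0 ⟨hy.1, hlt⟩) (by linarith)
  refine ⟨-dslope (varFun a) 1 y, by linarith, fun x hx => ?_⟩
  have h2 := hmax (⟨hx.1.le, hx.2.le⟩ : x ∈ Icc (0 : ℝ) 1)
  simp only [mem_ofPred_eq] at h2
  rw [dslope_of_ne _ hx.2.ne, slope_def_field, varFun_one h0 h1, sub_zero,
    div_le_iff_of_neg (by linarith [hx.2])] at h2
  rw [← varFun_eq a hx.1.ne']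
  linarith

/-- A summable majorant of the correlations, uniform in the Hurst parameter. Near `x = 1` both the
variance and the covariances at large lags vanish linearly. -/
lemma exists_corrFun_bound (ha : a ≠ 0) (h0 : ∑ q, a q = 0)
    (h1 : ∑ q : Fin (ℓ + 1), ((q : ℕ) : ℝ) * a q = 0) (hτ : tau a ≠ 0) :
    ∃ b : ℤ → ℝ, Summable b ∧ ∀ x ∈ Ioo (0 : ℝ) 1, ∀ j, |corrFun a x j| ≤ b j := by
  obtain ⟨C, hC, hCb⟩ := exists_abs_covFun_le_of_large h0 h1
  obtain ⟨c, hc, hcb⟩ := exists_le_covFun_zero ha h0 h1 hτ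
  let N : ℤ := 2 * ((ℓ : ℤ) + 1)
  refine ⟨fun j => (if j ∈ Finset.Ioo (-N) N then 1 else 0) + C / c * (1 / (j : ℝ) ^ 2), ?_, ?_⟩
  · refine Summable.add (summable_of_hasFiniteSupport ?_)
      ((Real.summable_one_div_int_pow.2 one_lt_two).mul_left _)
    refine (Finset.Ioo (-N) N).finite_toSet.subset fun j hj => ?_
    by_contra hj'
    exact hj (if_neg hj')
  · intro x hx j
    have hpos := covFun_zero_pos ha h0 hx
    have h2 : 0 ≤ C / c * (1 / (j : ℝ) ^ 2) := by positivity
    rw [corrFun, abs_div, abs_of_pos hpos]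
    beta_reduce
    split_ifs with hj
    · have := (div_le_one hpos).2 (abs_covFun_le h0 hx j)
      linarith
    · rw [zero_add, div_le_iff₀ hpos]
      have hj' : N ≤ |j| := by
        rw [Finset.mem_Ioo, ← abs_lt] at hj
        exact not_lt.1 hj
      refine (hCb x hx j hj').trans ?_
      have h3 := hcb x hx
      have h4 : C * (1 - x) * (1 / (j : ℝ) ^ 2) = C / c * (1 / (j : ℝ) ^ 2) * (c * (1 - x)) := by
        field_simp
      rw [h4]
      gcongr

lemma summable_corrFun (ha : a ≠ 0) (h0 : ∑ q, a q = 0)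
    (h1 : ∑ q : Fin (ℓ + 1), ((q : ℕ) : ℝ) * a q = 0) (hτ : tau a ≠ 0)
    (hx : x ∈ Ioo (0 : ℝ) 1) : Summable fun j : ℤ => |corrFun a x j| := by
  obtain ⟨b, hb, hle⟩ := exists_corrFun_bound ha h0 h1 hτ
  exact Summable.of_nonneg_of_le (fun _ => abs_nonneg _) (hle x hx) hb

lemma bddAbove_corrNorm (ha : a ≠ 0) (h0 : ∑ q, a q = 0)
    (h1 : ∑ q : Fin (ℓ + 1), ((q : ℕ) : ℝ) * a q = 0) (hτ : tau a ≠ 0) :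
    BddAbove (corrNorm a '' Ioo 0 1) := by
  obtain ⟨b, hb, hle⟩ := exists_corrFun_bound ha h0 h1 hτ
  refine ⟨∑' j, b j, ?_⟩
  rintro _ ⟨x, hx, rfl⟩
  exact (summable_corrFun ha h0 h1 hτ hx).tsum_le_tsum (hle x hx) hb

lemma two_mul_sum_corrFun_le (ha : a ≠ 0) (h0 : ∑ q, a q = 0)
    (h1 : ∑ q : Fin (ℓ + 1), ((q : ℕ) : ℝ) * a q = 0) (hτ : tau a ≠ 0)
    (hx : x ∈ Ioo (0 : ℝ) 1) (s : Finset ℤ) : 2 * ∑ j ∈ s, |corrFun a x j| ≤ kappa a := by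
  unfold kappa
  gcongr
  exact ((summable_corrFun ha h0 h1 hτ hx).sum_le_tsum s fun _ _ => abs_nonneg _).trans
    (le_csSup (bddAbove_corrNorm ha h0 h1 hτ) ⟨x, hx, rfl⟩)

lemma kappa_pos (ha : a ≠ 0) (h0 : ∑ q, a q = 0)
    (h1 : ∑ q : Fin (ℓ + 1), ((q : ℕ) : ℝ) * a q = 0) (hτ : tau a ≠ 0) : 0 < kappa a := by
  have hx : (1 / 2 : ℝ) ∈ Ioo (0 : ℝ) 1 := by norm_num
  have h := two_mul_sum_corrFun_le ha h0 h1 hτ hx {0}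
  rw [Finset.sum_singleton, corrFun, div_self (covFun_zero_pos ha h0 hx).ne', abs_one] at h
  linarith

end Kappa

/-! ### The tail bounds and their quantiles -/

section Quantiles

/-- The function `log (1 + y) - y`, in terms of which both tail bounds are written: `y = t / √m` for
the right one and `y = -t / √m` for the left one. -/
noncomputable def logSub (y : ℝ) : ℝ := Real.log (1 + y) - y

lemma log_sub_log_le {u v : ℝ} (hu : 0 < u) (hv : 0 < v) :
    Real.log v - Real.log u ≤ (v - u) / u := by
  rw [← Real.log_div hv.ne' hu.ne', sub_div, div_self hu.ne']
  exact Real.log_le_sub_one_of_pos (div_pos hv hu)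

lemma logSub_antitoneOn : AntitoneOn logSub (Ici 0) := by
  intro y hy z hz hyz
  have hy' : (0 : ℝ) ≤ y := hy
  have h1 := log_sub_log_le (u := 1 + y) (v := 1 + z) (by linarith) (by linarith)
  have h2 : (1 + z - (1 + y)) / (1 + y) ≤ z - y := by
    rw [div_le_iff₀ (by linarith)]
    nlinarith
  unfold logSub
  linarith

lemma logSub_monotoneOn : MonotoneOn logSub (Ioc (-1) 0) := by
  intro y hy z hz hyz
  have h1 := log_sub_log_le (u := 1 + z) (v := 1 + y) (by linarith [hz.1]) (by linarith [hy.1])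
  have h2 : (1 + y - (1 + z)) / (1 + z) ≤ y - z := by
    rw [div_le_iff₀ (by linarith [hz.1])]
    nlinarith [hz.2]
  unfold logSub
  linarith

lemma abs_logSub_add_le {y : ℝ} (hy : |y| ≤ 1 / 2) : |logSub y + y ^ 2 / 2| ≤ 2 * |y| ^ 3 := by
  have h1 := Real.abs_log_sub_add_sum_range_le (x := -y) (by rw [abs_neg]; linarith) 2
  rw [abs_neg, sub_neg_eq_add] at h1
  have h2 : ∑ i ∈ Finset.range 2, (-y) ^ (i + 1) / ((i : ℝ) + 1) + Real.log (1 + y) =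
      logSub y + y ^ 2 / 2 := by
    simp only [Finset.sum_range_succ, Finset.sum_range_zero, logSub]
    push_cast
    ring
  rw [h2] at h1
  refine h1.trans ?_
  rw [div_le_iff₀ (by linarith)]
  have : 0 ≤ |y| ^ 3 := by positivity
  calc |y| ^ (2 + 1) = |y| ^ 3 * 1 := by ring
    _ ≤ |y| ^ 3 * (2 * (1 - |y|)) := by gcongr; linarith
    _ = 2 * |y| ^ 3 * (1 - |y|) := by ring

lemma tendsto_mul_logSub (t : ℝ) :
    Tendsto (fun m : ℕ => (m : ℝ) * logSub (t / √(m : ℝ))) atTop (𝓝 (-(t ^ 2 / 2))) := by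
  have hsqrt : Tendsto (fun m : ℕ => √(m : ℝ)) atTop atTop :=
    Real.tendsto_sqrt_atTop.comp tendsto_natCast_atTop_atTop
  have hb : Tendsto (fun m : ℕ => 2 * |t| ^ 3 / √(m : ℝ)) atTop (𝓝 0) :=
    hsqrt.const_div_atTop _
  rw [tendsto_iff_norm_sub_tendsto_zero]
  refine squeeze_zero' (Eventually.of_forall fun _ => norm_nonneg _) ?_ hb
  filter_upwards [hsqrt.eventually_ge_atTop (2 * |t| + 1)] with m hm
  have hs : 0 < √(m : ℝ) := by linarith [abs_nonneg t]
  have hm0 : (0 : ℝ) ≤ m := Nat.cast_nonneg m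
  have hsq : (m : ℝ) = √(m : ℝ) ^ 2 := (Real.sq_sqrt hm0).symm
  have habs : |t / √(m : ℝ)| = |t| / √(m : ℝ) := by rw [abs_div, abs_of_pos hs]
  have h1 := abs_logSub_add_le (y := t / √(m : ℝ)) (by
    rw [habs, div_le_iff₀ hs]
    linarith)
  have h2 : (m : ℝ) * logSub (t / √(m : ℝ)) - -(t ^ 2 / 2) =
      m * (logSub (t / √(m : ℝ)) + (t / √(m : ℝ)) ^ 2 / 2) := by
    have : (m : ℝ) * ((t / √(m : ℝ)) ^ 2 / 2) = t ^ 2 / 2 := by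
      rw [div_pow, Real.sq_sqrt hm0]
      have : (m : ℝ) ≠ 0 := by rw [hsq]; positivity
      field_simp
    linarith
  rw [Real.norm_eq_abs, h2, abs_mul, abs_of_nonneg hm0]
  calc (m : ℝ) * |logSub (t / √(m : ℝ)) + (t / √(m : ℝ)) ^ 2 / 2|
      ≤ m * (2 * |t / √(m : ℝ)| ^ 3) := by gcongr
    _ = 2 * |t| ^ 3 / √(m : ℝ) := by
        rw [habs, div_pow]
        nth_rewrite 1 [hsq]
        field_simp

variable {m : ℕ} {κ t β : ℝ}

lemma phiR_eq (hm : 0 < m) (ht : 0 ≤ t) :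
    phiR m κ t = Real.exp ((m : ℝ) * logSub (t / √(m : ℝ)) / κ) := by
  have hm' : (0 : ℝ) < m := by exact_mod_cast hm
  have hs : 0 < √(m : ℝ) := Real.sqrt_pos.2 hm'
  have h1 : 0 < 1 + t / √(m : ℝ) := by positivity
  rw [phiR, Real.rpow_def_of_pos h1, ← Real.exp_add, logSub]
  congr 1
  have : t * √(m : ℝ) = m * (t / √(m : ℝ)) := by
    nth_rewrite 2 [← Real.sq_sqrt hm'.le]
    field_simp
  rw [this]
  ring

lemma phiL_eq (hm : 0 < m) (ht : t ∈ Ico 0 √(m : ℝ)) :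
    phiL m κ t = Real.exp ((m : ℝ) * logSub (-t / √(m : ℝ)) / κ) := by
  have hm' : (0 : ℝ) < m := by exact_mod_cast hm
  have hs : 0 < √(m : ℝ) := Real.sqrt_pos.2 hm'
  have h1 : 0 < 1 - t / √(m : ℝ) := by
    rw [sub_pos, div_lt_one hs]
    exact ht.2
  rw [phiL, indicator_of_mem (Ico_subset_Icc_self ht), Real.rpow_def_of_pos h1, ← Real.exp_add,
    logSub, neg_div, ← sub_eq_add_neg]
  congr 1
  have : t * √(m : ℝ) = m * (t / √(m : ℝ)) := by
    nth_rewrite 2 [← Real.sq_sqrt hm'.le]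
    field_simp
  rw [this]
  ring

lemma phiR_antitoneOn (hm : 0 < m) (hκ : 0 < κ) : AntitoneOn (phiR m κ) (Ici 0) := by
  intro y hy z hz hyz
  rw [phiR_eq hm hy, phiR_eq hm hz]
  have hy' : (0 : ℝ) ≤ y := hy
  have hz' : (0 : ℝ) ≤ z := hz
  have := logSub_antitoneOn (mem_Ici.2 (by positivity : 0 ≤ y / √(m : ℝ)))
    (mem_Ici.2 (by positivity : 0 ≤ z / √(m : ℝ))) (by gcongr)
  gcongr

lemma phiL_antitoneOn (hm : 0 < m) (hκ : 0 < κ) : AntitoneOn (phiL m κ) (Ico 0 √(m : ℝ)) := by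
  have hs : 0 < √(m : ℝ) := Real.sqrt_pos.2 (by exact_mod_cast hm)
  have hmem : ∀ y ∈ Ico 0 √(m : ℝ), -y / √(m : ℝ) ∈ Ioc (-1 : ℝ) 0 := by
    intro y hy
    constructor
    · rw [lt_div_iff₀ hs]
      linarith [hy.2]
    · exact div_nonpos_of_nonpos_of_nonneg (by linarith [hy.1]) hs.le
  intro y hy z hz hyz
  rw [phiL_eq hm hy, phiL_eq hm hz]
  have := logSub_monotoneOn (hmem z hz) (hmem y hy) (by gcongr)
  gcongr

lemma exists_phiR_eq (hm : 0 < m) (hκ : 0 < κ) (hβ : β ∈ Ioo (0 : ℝ) 1) :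
    ∃ t ∈ Ioi (0 : ℝ), phiR m κ t = β := by
  have hm' : (0 : ℝ) < m := by exact_mod_cast hm
  have hs : 0 < √(m : ℝ) := Real.sqrt_pos.2 hm'
  have hlog : Real.log β < 0 := Real.log_neg hβ.1 hβ.2
  -- `log (1 + y) - y ≤ (1 - y) / 2` makes `phiR` at most `β` at this point
  set y : ℝ := 1 + 2 * (κ / m) * (-Real.log β) with hy
  have hy1 : 0 < y := by
    have : 0 ≤ 2 * (κ / m) * (-Real.log β) := mul_nonneg (by positivity) (by linarith)
    linarith
  have hle : phiR m κ (y * √(m : ℝ)) ≤ β := by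
    rw [phiR_eq hm (by positivity), mul_div_cancel_right₀ _ hs.ne']
    rw [← Real.exp_log hβ.1, Real.exp_le_exp, div_le_iff₀ hκ]
    have h1 : logSub y ≤ (1 - y) / 2 := by
      have h2 := log_sub_log_le (u := 2) (v := 1 + y) two_pos (by linarith)
      have h3 := Real.log_two_lt_d9
      unfold logSub
      linarith
    calc (m : ℝ) * logSub y ≤ m * ((1 - y) / 2) := by gcongr
      _ = Real.log β * κ := by rw [hy]; field_simp; ring
  have hcont : ContinuousOn (phiR m κ) (Icc 0 (y * √(m : ℝ))) := by
    refine ContinuousOn.mul (by fun_prop) (ContinuousOn.rpow_const (by fun_prop) fun t ht => ?_)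
    have : 0 ≤ t := ht.1
    exact Or.inl (by positivity)
  have h0 : phiR m κ 0 = 1 := by simp [phiR]
  obtain ⟨t, ht, htβ⟩ := intermediate_value_Icc' (by positivity) hcont
    ⟨hle, by rw [h0]; exact hβ.2.le⟩
  refine ⟨t, lt_of_le_of_ne ht.1 ?_, htβ⟩
  rintro rfl
  exact hβ.2.ne (htβ.symm.trans h0)

lemma exists_phiL_eq (hm : 0 < m) (hκ : 0 < κ) (hβ : β ∈ Ioo (0 : ℝ) 1) :
    ∃ t ∈ Ioo 0 √(m : ℝ), phiL m κ t = β := by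
  have hm' : (0 : ℝ) < m := by exact_mod_cast hm
  have hs : 0 < √(m : ℝ) := Real.sqrt_pos.2 hm'
  have hexp : 0 < (m : ℝ) / κ := by positivity
  have hcont : ContinuousOn (phiL m κ) (Icc 0 √(m : ℝ)) := by
    refine ContinuousOn.congr (f := fun t => Real.exp (t * √(m : ℝ) / κ) *
      (1 - t / √(m : ℝ)) ^ ((m : ℝ) / κ)) ?_ fun t ht => indicator_of_mem ht _
    exact ContinuousOn.mul (by fun_prop)
      (ContinuousOn.rpow_const (by fun_prop) fun t _ => Or.inr hexp.le)
  have h0 : phiL m κ 0 = 1 := by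
    rw [phiL, indicator_of_mem (left_mem_Icc.2 hs.le)]
    simp
  have h1 : phiL m κ √(m : ℝ) = 0 := by
    rw [phiL, indicator_of_mem (right_mem_Icc.2 hs.le), div_self hs.ne', sub_self,
      Real.zero_rpow hexp.ne', mul_zero]
  have hmem : β ∈ Icc (phiL m κ √(m : ℝ)) (phiL m κ 0) := by
    rw [h0, h1]
    exact Ioo_subset_Icc_self hβ
  obtain ⟨t, ht, htβ⟩ := intermediate_value_Icc' hs.le hcont hmem
  refine ⟨t, ⟨lt_of_le_of_ne ht.1 ?_, lt_of_le_of_ne ht.2 ?_⟩, htβ⟩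
  · rintro rfl
    exact hβ.2.ne (htβ.symm.trans h0)
  · rintro rfl
    exact hβ.1.ne' (htβ.symm.trans h1)

variable {ℓ : ℕ} {a : Fin (ℓ + 1) → ℝ}

lemma quantR_spec (hm : 0 < m) (hκ : 0 < kappa a) (hβ : β ∈ Ioo (0 : ℝ) 1) :
    0 < quantR a m β ∧ phiR m (kappa a) (quantR a m β) = β :=
  Function.invFunOn_pos (exists_phiR_eq hm hκ hβ)

lemma quantL_spec (hm : 0 < m) (hκ : 0 < kappa a) (hβ : β ∈ Ioo (0 : ℝ) 1) :
    quantL a m β ∈ Ioo 0 √(m : ℝ) ∧ phiL m (kappa a) (quantL a m β) = β :=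
  Function.invFunOn_pos (exists_phiL_eq hm hκ hβ)

/-- The Gaussian limit of the tail bounds takes the value `β` at `quantLim a β`. -/
lemma exp_quantLim (hκ : 0 < kappa a) (hβ : β ∈ Ioo (0 : ℝ) 1) :
    Real.exp (-(quantLim a β ^ 2 / 2) / kappa a) = β := by
  have hlog : 0 < Real.log (1 / β) := Real.log_pos (by rw [one_div]; exact one_lt_inv_iff₀.2 hβ)
  rw [quantLim, Real.sq_sqrt (by positivity)]
  have : -(2 * kappa a * Real.log (1 / β) / 2) / kappa a = Real.log β := by
    rw [one_div, Real.log_inv]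
    field_simp
  rw [this, Real.exp_log hβ.1]

lemma quantLim_pos (hκ : 0 < kappa a) (hβ : β ∈ Ioo (0 : ℝ) 1) : 0 < quantLim a β := by
  have hlog : 0 < Real.log (1 / β) := Real.log_pos (by rw [one_div]; exact one_lt_inv_iff₀.2 hβ)
  exact Real.sqrt_pos.2 (by positivity)

/-- Inverses at a fixed level of decreasing functions converging pointwise to
`t ↦ exp (-t ^ 2 / (2 κ))` converge to the inverse of the limit. -/
lemma tendsto_of_tendsto_phi {φ : ℕ → ℝ → ℝ} {q : ℕ → ℝ} {L : ℝ} (hκ : 0 < κ) (hL : 0 < L)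
    (hβ : Real.exp (-(L ^ 2 / 2) / κ) = β)
    (hφ : ∀ t, 0 < t → Tendsto (fun m => φ m t) atTop (𝓝 (Real.exp (-(t ^ 2 / 2) / κ))))
    (hanti : ∀ t, 0 < t → ∀ᶠ m in atTop, ∀ s, 0 < s →
      (s ≤ t → φ m s = β → φ m t ≤ β) ∧ (t ≤ s → φ m s = β → β ≤ φ m t))
    (hq : ∀ᶠ m in atTop, 0 < q m ∧ φ m (q m) = β) : Tendsto q atTop (𝓝 L) := by
  rw [tendsto_order]
  constructor
  · intro b hb
    rcases le_or_gt b 0 with hb0 | hb0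
    · filter_upwards [hq] with m hm
      exact hb0.trans_lt hm.1
    · have h1 : β < Real.exp (-(b ^ 2 / 2) / κ) := by
        rw [← hβ]
        gcongr
      filter_upwards [hq, hanti b hb0, (hφ b hb0).eventually_const_lt h1] with m hm ha hlt
      by_contra! hcon
      exact absurd ((ha _ hm.1).1 hcon hm.2) (not_le.2 hlt)
  · intro b hb
    have hb0 : 0 < b := hL.trans hb
    have h1 : Real.exp (-(b ^ 2 / 2) / κ) < β := by
      rw [← hβ]
      gcongr
    filter_upwards [hq, hanti b hb0, (hφ b hb0).eventually_lt_const h1] with m hm ha hlt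
    by_contra! hcon
    exact absurd ((ha _ hm.1).2 hcon hm.2) (not_le.2 hlt)

lemma tendsto_quantR (hκ : 0 < kappa a) (hβ : β ∈ Ioo (0 : ℝ) 1) :
    Tendsto (fun m => quantR a m β) atTop (𝓝 (quantLim a β)) := by
  refine tendsto_of_tendsto_phi (φ := fun m => phiR m (kappa a)) hκ (quantLim_pos hκ hβ)
    (exp_quantLim hκ hβ) (fun t ht => ?_) (fun t ht => ?_) ?_
  · refine Tendsto.congr' ?_ ((Real.continuous_exp.tendsto _).comp
      ((tendsto_mul_logSub t).div_const (kappa a)))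
    filter_upwards [eventually_gt_atTop 0] with m hm
    exact (phiR_eq hm ht.le).symm
  · filter_upwards [eventually_gt_atTop 0] with m hm s hs
    exact ⟨fun h he => he ▸ phiR_antitoneOn hm hκ hs.le ht.le h,
      fun h he => he ▸ phiR_antitoneOn hm hκ ht.le hs.le h⟩
  · filter_upwards [eventually_gt_atTop 0] with m hm
    exact quantR_spec hm hκ hβ

lemma tendsto_quantL (hκ : 0 < kappa a) (hβ : β ∈ Ioo (0 : ℝ) 1) :
    Tendsto (fun m => quantL a m β) atTop (𝓝 (quantLim a β)) := by
  have hsqrt : Tendsto (fun m : ℕ => √(m : ℝ)) atTop atTop :=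
    Real.tendsto_sqrt_atTop.comp tendsto_natCast_atTop_atTop
  refine tendsto_of_tendsto_phi (φ := fun m => phiL m (kappa a)) hκ (quantLim_pos hκ hβ)
    (exp_quantLim hκ hβ) (fun t ht => ?_) (fun t ht => ?_) ?_
  · have h1 := (tendsto_mul_logSub (-t)).div_const (kappa a)
    rw [neg_sq] at h1
    refine Tendsto.congr' ?_ ((Real.continuous_exp.tendsto _).comp h1)
    filter_upwards [eventually_gt_atTop 0, hsqrt.eventually_gt_atTop t] with m hm hmt
    exact (phiL_eq hm ⟨ht.le, hmt⟩).symm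
  · filter_upwards [eventually_gt_atTop 0, hsqrt.eventually_gt_atTop t] with m hm hmt s hs
    have hsm : phiL m (kappa a) s = β → s < √(m : ℝ) := by
      intro he
      by_contra! hcon
      refine hβ.1.ne' (he.symm.trans ?_)
      rcases hcon.eq_or_lt with h | h
      · have hs' : 0 < √(m : ℝ) := ht.trans hmt
        rw [← h, phiL, indicator_of_mem (right_mem_Icc.2 hs'.le), div_self hs'.ne', sub_self,
          Real.zero_rpow (by positivity), mul_zero]
      · exact indicator_of_notMem (fun hmem => h.not_ge hmem.2) _
    exact ⟨fun h he => he ▸ phiL_antitoneOn hm hκ ⟨hs.le, hsm he⟩ ⟨ht.le, hmt⟩ h,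
      fun h he => he ▸ phiL_antitoneOn hm hκ ⟨ht.le, hmt⟩ ⟨hs.le, hsm he⟩ h⟩
  · filter_upwards [eventually_gt_atTop 0] with m hm
    have h := quantL_spec hm hκ hβ
    exact ⟨h.1.1, h.2⟩

end Quantiles

/-! ### Fractional Brownian motion and its filtered series -/

section FilteredSeries

variable {Ω : Type*} {B : ℝ → Ω → ℝ} {H : ℝ} {ℓ : ℕ} {a : Fin (ℓ + 1) → ℝ} {n : ℕ}

lemma statS_eq (hn : ℓ + 1 ≤ n) (ω : Ω) :
    ((n : ℝ) - ℓ) * statS B a n ω = ∑ i : Finset.Ico ℓ n, filtered B a n i ω ^ 2 := by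
  have : (0 : ℝ) < (n : ℝ) - ℓ := by
    rw [sub_pos]
    exact_mod_cast hn
  rw [Finset.sum_coe_sort _ fun i => filtered B a n i ω ^ 2, statS]
  field_simp

/-- The mean `n ^ (-2 * H) * π_H^a(0)` of the statistic `S_n^a`. -/
noncomputable def meanS (a : Fin (ℓ + 1) → ℝ) (H : ℝ) (n : ℕ) : ℝ :=
  (n : ℝ) ^ (-(2 * H)) * covFun a H 0

lemma meanS_pos (ha : a ≠ 0) (h0 : ∑ q, a q = 0) (hH : H ∈ Ioo (0 : ℝ) 1) (hn : 0 < n) :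
    0 < meanS a H n :=
  mul_pos (Real.rpow_pos_of_pos (by exact_mod_cast hn) _) (covFun_zero_pos ha h0 hH)

lemma log_meanS (ha : a ≠ 0) (h0 : ∑ q, a q = 0) (hH : H ∈ Ioo (0 : ℝ) 1) (hn : 0 < n) :
    Real.log (meanS a H n) = -gFun a n H := by
  have hn' : (0 : ℝ) < n := by exact_mod_cast hn
  rw [meanS, Real.log_mul (Real.rpow_pos_of_pos hn' _).ne' (covFun_zero_pos ha h0 hH).ne',
    Real.log_rpow hn', gFun]
  ring

variable [MeasurableSpace Ω] {P : Measure Ω}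

lemma IsFBM.memLp (hB : IsFBM B H 1 P) (t : ℝ) : MemLp (B t) 2 P :=
  (hB.gaussian.hasGaussianLaw_eval t).memLp_two

lemma aemeasurable_filtered (hB : IsFBM B H 1 P) (n i : ℕ) :
    AEMeasurable (filtered B a n i) P :=
  Finset.aemeasurable_fun_sum _ fun _ _ => (hB.gaussian.aemeasurable _).const_mul _

lemma integral_filtered (hB : IsFBM B H 1 P) (n i : ℕ) : ∫ ω, filtered B a n i ω ∂P = 0 := by
  unfold filtered
  rw [integral_finsetSum _ fun q _ =>
    ((hB.gaussian.hasGaussianLaw_eval _).integrable).const_mul _]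
  simp [integral_const_mul, hB.centered]

lemma hasGaussianLaw_filtered (hB : IsFBM B H 1 P) (n : ℕ) (s : Finset ℕ) :
    HasGaussianLaw (fun ω (i : s) => filtered B a n i ω) P := by
  classical
  let t : s → Fin (ℓ + 1) → ℝ := fun i q => (((i : ℕ) : ℝ) - ((q : ℕ) : ℝ)) / (n : ℝ)
  let I : Finset ℝ := Finset.univ.image fun iq : s × Fin (ℓ + 1) => t iq.1 iq.2
  have hI : ∀ i q, t i q ∈ I := fun i q => Finset.mem_image.2 ⟨(i, q), Finset.mem_univ _, rfl⟩
  let L : (I → ℝ) →L[ℝ] (s → ℝ) := ContinuousLinearMap.pi fun i =>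
    ∑ q, a q • ContinuousLinearMap.proj (R := ℝ) (φ := fun _ : I => ℝ) ⟨t i q, hI i q⟩
  have h1 := (hB.gaussian.hasGaussianLaw I).map_fun L
  have h2 : (fun ω => L (I.restrict (B · ω))) = fun ω (i : s) => filtered B a n i ω := by
    ext ω i
    simp [L, filtered, t]
  rwa [h2] at h1

variable [IsProbabilityMeasure P]

lemma IsFBM.zero_ae_eq (hH : H ≠ 0) (hB : IsFBM B H 1 P) : B 0 =ᵐ[P] 0 := by
  have h1 : variance (B 0) P = 0 := by
    rw [hB.variance_eq, abs_zero, Real.zero_rpow (mul_ne_zero two_ne_zero hH), mul_zero]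
  have h2 := ae_eq_integral_of_variance_eq_zero (hB.memLp 0) h1
  rw [hB.centered] at h2
  exact h2

lemma IsFBM.variance_sub (hH : H ≠ 0) (hB : IsFBM B H 1 P) (s t : ℝ) :
    variance (fun ω => B s ω - B t ω) P = |s - t| ^ (2 * H) := by
  have h1 := (hB.stationary_increments t {s - t}).comp
    (measurable_pi_apply (⟨s - t, Finset.mem_singleton_self _⟩ : ({s - t} : Finset ℝ)))
  have h2 := h1.variance_eq
  simp only [Function.comp_def, sub_add_cancel] at h2
  rw [h2]
  have h3 : (fun ω => B (s - t) ω - B 0 ω) =ᵐ[P] B (s - t) := by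
    filter_upwards [hB.zero_ae_eq hH] with ω hω
    simp [hω]
  rw [variance_congr h3, hB.variance_eq, one_pow, one_mul]

lemma IsFBM.covariance_eq (hH : H ≠ 0) (hB : IsFBM B H 1 P) (s t : ℝ) :
    cov[B s, B t; P] = (|s| ^ (2 * H) + |t| ^ (2 * H) - |s - t| ^ (2 * H)) / 2 := by
  have h1 := variance_fun_sub (hB.memLp s) (hB.memLp t)
  rw [hB.variance_sub hH, hB.variance_eq, hB.variance_eq] at h1
  linarith

lemma covariance_filtered (hH : H ≠ 0) (hB : IsFBM B H 1 P) (h0 : ∑ q, a q = 0) (n i j : ℕ) :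
    cov[filtered B a n i, filtered B a n j; P] =
      (n : ℝ) ^ (-(2 * H)) * covFun a H ((j : ℤ) - i) := by
  have hmem : ∀ i : ℕ, ∀ q : Fin (ℓ + 1),
      MemLp (fun ω => a q * B (((i : ℝ) - ((q : ℕ) : ℝ)) / (n : ℝ)) ω) 2 P :=
    fun i q => (hB.memLp _).const_mul _
  change cov[fun ω => ∑ q, a q * B (((i : ℝ) - ((q : ℕ) : ℝ)) / (n : ℝ)) ω,
    fun ω => ∑ q, a q * B (((j : ℝ) - ((q : ℕ) : ℝ)) / (n : ℝ)) ω; P] = _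
  rw [covariance_fun_sum_fun_sum (hmem i) (hmem j)]
  simp_rw [covariance_const_mul_left, covariance_const_mul_right, hB.covariance_eq hH]
  have hdiff : ∀ q r : Fin (ℓ + 1),
      |((i : ℝ) - ((q : ℕ) : ℝ)) / (n : ℝ) - ((j : ℝ) - ((r : ℕ) : ℝ)) / (n : ℝ)| ^ (2 * H) =
      (n : ℝ) ^ (-(2 * H)) *
        |((q : ℕ) : ℝ) - ((r : ℕ) : ℝ) + (((j : ℤ) - (i : ℤ) : ℤ) : ℝ)| ^ (2 * H) := by
    intro q r
    rw [← sub_div, abs_div, Real.div_rpow (abs_nonneg _) (abs_nonneg _),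
      abs_of_nonneg (Nat.cast_nonneg n : (0 : ℝ) ≤ n), Real.rpow_neg (Nat.cast_nonneg n),
      div_eq_inv_mul, ← abs_neg]
    congr 3
    push_cast
    ring
  simp_rw [hdiff]
  have hsplit : ∀ x y z w b c : ℝ, b * (c * ((x + y - w * z) / 2)) =
      b * x / 2 * c + b * (c * y / 2) + w * (-(1 / 2) * (b * c * z)) := by
    intros
    ring
  simp_rw [hsplit, Finset.sum_add_distrib, ← Finset.mul_sum, ← Finset.sum_mul, h0, covFun]
  simp

lemma variance_filtered (hH : H ≠ 0) (hB : IsFBM B H 1 P) (h0 : ∑ q, a q = 0) (n i : ℕ) :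
    variance (filtered B a n i) P = meanS a H n := by
  rw [← covariance_self (aemeasurable_filtered hB n i), covariance_filtered hH hB h0, sub_self,
    meanS]

lemma two_mul_sum_abs_covariance_le (hH : H ∈ Ioo (0 : ℝ) 1) (hB : IsFBM B H 1 P) (ha : a ≠ 0)
    (h0 : ∑ q, a q = 0) (h1 : ∑ q : Fin (ℓ + 1), ((q : ℕ) : ℝ) * a q = 0) (hτ : tau a ≠ 0)
    (n i : ℕ) (s : Finset ℕ) :
    2 * ∑ j : s, |cov[filtered B a n i, filtered B a n j; P]| ≤ meanS a H n * kappa a := by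
  have hpos := covFun_zero_pos ha h0 hH
  have hn : 0 ≤ (n : ℝ) ^ (-(2 * H)) := Real.rpow_nonneg (Nat.cast_nonneg n) _
  have h2 : ∀ j : ℕ, |cov[filtered B a n i, filtered B a n j; P]| =
      meanS a H n * |corrFun a H ((j : ℤ) - i)| := by
    intro j
    rw [covariance_filtered hH.1.ne' hB h0, meanS, corrFun, abs_mul, abs_div, abs_of_nonneg hn,
      abs_of_pos hpos]
    field_simp
  simp_rw [h2]
  rw [Finset.sum_coe_sort s fun j => meanS a H n * |corrFun a H ((j : ℤ) - i)|,
    ← Finset.mul_sum, mul_left_comm]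
  refine mul_le_mul_of_nonneg_left ?_ (mul_nonneg hn hpos.le)
  have h3 := two_mul_sum_corrFun_le ha h0 h1 hτ hH (s.image fun j : ℕ => (j : ℤ) - i)
  rwa [Finset.sum_image fun j _ k _ hjk => by simpa using hjk] at h3

lemma sum_variance_filtered (hH : H ≠ 0) (hB : IsFBM B H 1 P) (h0 : ∑ q, a q = 0)
    (hn : ℓ + 1 ≤ n) :
    ∑ i : Finset.Ico ℓ n, variance (filtered B a n i) P = ((n : ℝ) - ℓ) * meanS a H n := by
  simp_rw [variance_filtered hH hB h0]
  rw [Finset.sum_const, Finset.card_univ, Fintype.card_coe, Nat.card_Ico, nsmul_eq_mul,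
    Nat.cast_sub (by omega)]

variable {s : ℝ}

lemma measure_statS_ge_le (hH : H ∈ Ioo (0 : ℝ) 1) (hB : IsFBM B H 1 P) (ha : a ≠ 0)
    (h0 : ∑ q, a q = 0) (h1 : ∑ q : Fin (ℓ + 1), ((q : ℕ) : ℝ) * a q = 0) (hτ : tau a ≠ 0)
    (hn : ℓ + 1 ≤ n) (hs : 0 ≤ s) :
    P.real {ω | meanS a H n * (1 + s) ≤ statS B a n ω} ≤
      Real.exp ((n - ℓ : ℕ) * logSub s / kappa a) := by
  have hm : (0 : ℝ) < (n : ℝ) - ℓ := by rw [sub_pos]; exact_mod_cast hn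
  have hv := meanS_pos ha h0 hH (show 0 < n by omega)
  have hκ := kappa_pos ha h0 h1 hτ
  have h2 := measure_sum_sq_ge_le (hasGaussianLaw_filtered hB n (Finset.Ico ℓ n))
    (fun i => integral_filtered hB n i) (mul_pos hv hκ)
    (fun i => two_mul_sum_abs_covariance_le hH hB ha h0 h1 hτ n i _)
    (sum_variance_filtered hH.1.ne' hB h0 hn) hs
  simp_rw [← statS_eq hn, mul_assoc, mul_le_mul_iff_right₀ hm] at h2
  refine h2.trans_eq ?_
  rw [Real.rpow_def_of_pos (by linarith), ← Real.exp_add, logSub, Nat.cast_sub (by omega)]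
  congr 1
  field_simp
  ring

lemma measure_statS_le_le (hH : H ∈ Ioo (0 : ℝ) 1) (hB : IsFBM B H 1 P) (ha : a ≠ 0)
    (h0 : ∑ q, a q = 0) (h1 : ∑ q : Fin (ℓ + 1), ((q : ℕ) : ℝ) * a q = 0) (hτ : tau a ≠ 0)
    (hn : ℓ + 1 ≤ n) (hs : 0 ≤ s) (hs1 : s < 1) :
    P.real {ω | statS B a n ω ≤ meanS a H n * (1 - s)} ≤
      Real.exp ((n - ℓ : ℕ) * logSub (-s) / kappa a) := by
  have hm : (0 : ℝ) < (n : ℝ) - ℓ := by rw [sub_pos]; exact_mod_cast hn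
  have hv := meanS_pos ha h0 hH (show 0 < n by omega)
  have hκ := kappa_pos ha h0 h1 hτ
  have h2 := measure_sum_sq_le_le (hasGaussianLaw_filtered hB n (Finset.Ico ℓ n))
    (fun i => integral_filtered hB n i) (mul_pos hv hκ)
    (fun i => two_mul_sum_abs_covariance_le hH hB ha h0 h1 hτ n i _)
    (sum_variance_filtered hH.1.ne' hB h0 hn) hs hs1
  simp_rw [← statS_eq hn, mul_assoc, mul_le_mul_iff_right₀ hm] at h2
  refine h2.trans_eq ?_
  rw [Real.rpow_def_of_pos (by linarith), ← Real.exp_add, logSub, Nat.cast_sub (by omega),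
    ← sub_eq_add_neg]
  congr 1
  field_simp
  ring

/-- The two one-sided tail bounds at level `α / 2`. Where `statS` vanishes and its logarithm is a
junk value, the lower tail event holds. -/
theorem measure_bracketing_ge (hH : H ∈ Ioo (0 : ℝ) 1) (hB : IsFBM B H 1 P) (ha : a ≠ 0)
    (h0 : ∑ q, a q = 0) (h1 : ∑ q : Fin (ℓ + 1), ((q : ℕ) : ℝ) * a q = 0) (hτ : tau a ≠ 0)
    {α : ℝ} (hα : α ∈ Ioo (0 : ℝ) 1) (hn : ℓ + 1 ≤ n) :
    ENNReal.ofReal (1 - α) ≤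
      P {ω | lowerB B a α n ω ≤ gFun a n H ∧ gFun a n H ≤ upperB B a α n ω} := by
  have hκ := kappa_pos ha h0 h1 hτ
  have hβ : α / 2 ∈ Ioo (0 : ℝ) 1 := ⟨by linarith [hα.1], by linarith [hα.2]⟩
  have hm : 0 < n - ℓ := by omega
  have hsq : 0 < √((n - ℓ : ℕ) : ℝ) := Real.sqrt_pos.2 (by exact_mod_cast hm)
  have hv := meanS_pos ha h0 hH (show 0 < n by omega)
  have hlogv := log_meanS ha h0 hH (show 0 < n by omega)
  obtain ⟨hR0, hR⟩ := quantR_spec hm hκ hβ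
  obtain ⟨hL0, hL⟩ := quantL_spec hm hκ hβ
  have hxR : 0 < xR a (n - ℓ) (α / 2) := by unfold xR; positivity
  have hxL : 0 < xL a (n - ℓ) (α / 2) := by
    rw [xL, sub_pos, div_lt_one hsq]
    exact hL0.2
  have htR : P.real {ω | meanS a H n * xR a (n - ℓ) (α / 2) ≤ statS B a n ω} ≤ α / 2 := by
    refine (measure_statS_ge_le hH hB ha h0 h1 hτ hn (by positivity)).trans ?_
    rw [← phiR_eq hm hR0.le, hR]
  have htL : P.real {ω | statS B a n ω ≤ meanS a H n * xL a (n - ℓ) (α / 2)} ≤ α / 2 := by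
    refine (measure_statS_le_le hH hB ha h0 h1 hτ hn (div_nonneg hL0.1.le hsq.le)
      ((div_lt_one hsq).2 hL0.2)).trans ?_
    rw [← neg_div, ← phiL_eq hm ⟨hL0.1.le, hL0.2⟩, hL]
  set G : Set Ω := {ω | lowerB B a α n ω ≤ gFun a n H ∧ gFun a n H ≤ upperB B a α n ω}
  have hcover : (univ : Set Ω) ⊆ G ∪
      ({ω | meanS a H n * xR a (n - ℓ) (α / 2) ≤ statS B a n ω} ∪
        {ω | statS B a n ω ≤ meanS a H n * xL a (n - ℓ) (α / 2)}) := by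
    intro ω _
    by_contra! hcon
    simp only [mem_union, not_or, mem_ofPred_eq, not_le] at hcon
    obtain ⟨hG, hgR, hgL⟩ := hcon
    have hS : 0 < statS B a n ω := lt_trans (mul_pos hv hxL) hgL
    refine hG ⟨?_, ?_⟩
    · have h2 := Real.log_le_log (mul_pos hv hxL) hgL.le
      rw [Real.log_mul hv.ne' hxL.ne', hlogv] at h2
      unfold lowerB
      linarith
    · have h2 := Real.log_le_log hS hgR.le
      rw [Real.log_mul hv.ne' hxR.ne', hlogv] at h2
      unfold upperB
      linarith
  have h3 : 1 ≤ P.real G + (α / 2 + α / 2) := by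
    calc (1 : ℝ) = P.real univ := by simp
      _ ≤ _ := measureReal_mono hcover
      _ ≤ _ := measureReal_union_le _ _
      _ ≤ _ := by
        gcongr
        exact (measureReal_union_le _ _).trans (add_le_add htR htL)
  rw [← ofReal_measureReal]
  exact ENNReal.ofReal_le_ofReal (by linarith)

end FilteredSeries

/-! ### Monotonicity and range of `gFun` -/

section GFun

open scoped ContDiff

variable {ℓ : ℕ} {a : Fin (ℓ + 1) → ℝ} {n : ℕ} {x y : ℝ}

lemma contDiff_varFun (a : Fin (ℓ + 1) → ℝ) : ContDiff ℝ ω (varFun a) := by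
  refine contDiff_const.mul (ContDiff.sum fun q _ => ContDiff.sum fun r _ => ?_)
  split_ifs with h
  · exact contDiff_const
  · fun_prop

lemma deriv_varFun (a : Fin (ℓ + 1) → ℝ) : deriv (varFun a) = varFunDeriv a :=
  funext fun x => (hasDerivAt_varFun a x).deriv

lemma continuous_varFunDeriv (a : Fin (ℓ + 1) → ℝ) : Continuous (varFunDeriv a) :=
  deriv_varFun a ▸ (contDiff_varFun a).continuous_deriv (by norm_num)

lemma continuous_varFun (a : Fin (ℓ + 1) → ℝ) : Continuous (varFun a) :=
  (contDiff_varFun a).continuous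

lemma logRatio_eq (a : Fin (ℓ + 1) → ℝ) (hx : x ≠ 0) :
    logRatio a x = varFunDeriv a x / (2 * varFun a x) := by
  rw [varFun_eq a hx]
  simp only [logRatio, varFunDeriv, covFun, Int.cast_zero, add_zero]
  rw [← mul_assoc, show (2 : ℝ) * -(1 / 2) = -1 by norm_num, neg_one_mul, neg_div_neg_eq]

lemma bddAbove_logRatio (ha : a ≠ 0) (h0 : ∑ q, a q = 0) (hτ : 0 < tau a) :
    BddAbove (logRatio a '' Ioo 0 1) := by
  -- near `1` the ratio is negative, since `varFunDeriv a 1 = -tau a < 0`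
  have hnear : ∀ᶠ x in 𝓝 (1 : ℝ), varFunDeriv a x < 0 :=
    (continuous_varFunDeriv a).continuousAt.eventually_lt_const
      (by rw [varFunDeriv_one]; linarith)
  obtain ⟨δ, hδ, hball⟩ := Metric.eventually_nhds_iff.1 hnear
  have hcont : ContinuousOn (fun x => varFunDeriv a x / (2 * varFun a x)) (Icc 0 (1 - δ)) := by
    refine (continuous_varFunDeriv a).continuousOn.div
      (continuous_const.mul (continuous_varFun a)).continuousOn fun x hx => ?_
    exact (mul_pos two_pos (varFun_pos ha h0 ⟨hx.1, by linarith [hx.2]⟩)).ne'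
  obtain ⟨M, hM⟩ := isCompact_Icc.bddAbove_image hcont
  refine ⟨max M 0, ?_⟩
  rintro _ ⟨x, hx, rfl⟩
  rw [logRatio_eq a hx.1.ne']
  rcases le_or_gt x (1 - δ) with h | h
  · exact le_max_of_le_left (hM ⟨x, ⟨hx.1.le, h⟩, rfl⟩)
  · refine le_max_of_le_right (div_nonpos_of_nonpos_of_nonneg (hball ?_).le ?_)
    · rw [Real.dist_eq, abs_lt]
      constructor <;> linarith [hx.2]
    · exact (mul_pos two_pos (varFun_pos ha h0 ⟨hx.1.le, hx.2⟩)).le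

lemma gFun_eq (a : Fin (ℓ + 1) → ℝ) (n : ℕ) (hx : x ≠ 0) :
    gFun a n x = 2 * x * Real.log n - Real.log (varFun a x) := by
  rw [gFun, varFun_eq a hx]

lemma hasStrictDerivAt_log_varFun (ha : a ≠ 0) (h0 : ∑ q, a q = 0) (hx : x ∈ Ioo (0 : ℝ) 1) :
    HasStrictDerivAt (fun x => Real.log (varFun a x)) (varFunDeriv a x / varFun a x) x := by
  have h1 := (contDiff_varFun a).contDiffAt.hasStrictDerivAt (x := x) (by norm_num)
  rw [deriv_varFun] at h1
  exact h1.log (varFun_pos ha h0 ⟨hx.1.le, hx.2⟩).ne'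

lemma hasDerivAt_gFun (ha : a ≠ 0) (h0 : ∑ q, a q = 0) (n : ℕ) (hx : x ∈ Ioo (0 : ℝ) 1) :
    HasDerivAt (gFun a n) (2 * Real.log n - varFunDeriv a x / varFun a x) x := by
  have h1 : HasDerivAt (fun x => 2 * x * Real.log n - Real.log (varFun a x))
      (2 * Real.log n - varFunDeriv a x / varFun a x) x := by
    refine HasDerivAt.sub ?_ (hasStrictDerivAt_log_varFun ha h0 hx).hasDerivAt
    simpa using ((hasDerivAt_id x).const_mul 2).mul_const (Real.log n)
  refine h1.congr_of_eventuallyEq ?_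
  filter_upwards [Ioi_mem_nhds hx.1] with y hy
  exact gFun_eq a n (ne_of_gt hy)

lemma analyticOnNhd_gFun (ha : a ≠ 0) (h0 : ∑ q, a q = 0) (n : ℕ) :
    AnalyticOnNhd ℝ (gFun a n) (Ioo 0 1) := by
  intro x hx
  have h1 : AnalyticAt ℝ (fun x => 2 * x * Real.log n - Real.log (varFun a x)) x := by
    have h2 : AnalyticAt ℝ (varFun a) x := (contDiff_varFun a).contDiffAt.analyticAt
    have h3 := h2.log (varFun_pos ha h0 ⟨hx.1.le, hx.2⟩)
    exact ((analyticAt_const.mul analyticAt_id).mul analyticAt_const).sub h3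
  refine h1.congr ?_
  filter_upwards [Ioi_mem_nhds hx.1] with y hy
  exact (gFun_eq a n (ne_of_gt hy)).symm

lemma tendsto_gFun_zero (ha : a ≠ 0) (h0 : ∑ q, a q = 0) (n : ℕ) :
    Tendsto (gFun a n) (𝓝[>] 0) (𝓝 (-Real.log ((∑ q, a q ^ 2) / 2))) := by
  have hpos := varFun_pos ha h0 (left_mem_Ico.2 zero_lt_one)
  have h1 : Tendsto (fun x => 2 * x * Real.log n - Real.log (varFun a x)) (𝓝 0)
      (𝓝 (2 * 0 * Real.log n - Real.log (varFun a 0))) := by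
    refine Tendsto.sub (Continuous.tendsto (by fun_prop) 0) ?_
    exact (continuous_varFun a).continuousAt.log hpos.ne'
  rw [varFun_zero h0, mul_zero, zero_mul, zero_sub] at h1
  refine (h1.mono_left nhdsWithin_le_nhds).congr' ?_
  filter_upwards [self_mem_nhdsWithin] with y hy
  exact (gFun_eq a n (ne_of_gt hy)).symm

lemma tendsto_gFun_one (ha : a ≠ 0) (h0 : ∑ q, a q = 0)
    (h1 : ∑ q : Fin (ℓ + 1), ((q : ℕ) : ℝ) * a q = 0) (n : ℕ) :
    Tendsto (gFun a n) (𝓝[<] 1) atTop := by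
  have h2 : Tendsto (varFun a) (𝓝[<] 1) (𝓝[>] 0) := by
    refine tendsto_nhdsWithin_iff.2 ⟨?_, ?_⟩
    · have := ((continuous_varFun a).tendsto 1).mono_left
        (nhdsWithin_le_nhds (s := Iio (1 : ℝ)))
      rwa [varFun_one h0 h1] at this
    · filter_upwards [Ioo_mem_nhdsLT (zero_lt_one' ℝ)] with y hy
      exact varFun_pos ha h0 ⟨hy.1.le, hy.2⟩
  have h3 : Tendsto (fun x : ℝ => 2 * x * Real.log n) (𝓝[<] 1) (𝓝 (2 * 1 * Real.log n)) :=
    (Continuous.tendsto (by fun_prop) 1).mono_left nhdsWithin_le_nhds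
  have h4 := h3.add_atTop (tendsto_neg_atBot_atTop.comp (Real.tendsto_log_nhdsGT_zero.comp h2))
  refine h4.congr' ?_
  filter_upwards [Ioo_mem_nhdsLT (zero_lt_one' ℝ)] with y hy
  rw [gFun_eq a n hy.1.ne']
  rfl

lemma SampleSizeCond.logRatio_le (hb : BddAbove (logRatio a '' Ioo 0 1))
    (hn : SampleSizeCond a n) (hx : x ∈ Ioo (0 : ℝ) 1) : logRatio a x ≤ Real.log n := by
  have h1 : (0 : ℝ) < n := (Real.exp_pos _).trans_le hn
  exact (le_csSup hb ⟨x, hx, rfl⟩).trans ((Real.le_log_iff_exp_le h1).2 hn)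

lemma two_mul_sub_logRatio (a : Fin (ℓ + 1) → ℝ) (n : ℕ) (hx : x ∈ Ioo (0 : ℝ) 1) :
    2 * Real.log n - varFunDeriv a x / varFun a x = 2 * (Real.log n - logRatio a x) := by
  rw [logRatio_eq a hx.1.ne', mul_comm 2 (varFun a x), ← div_div]
  ring

/-- The derivative of `gFun a n` may vanish where `logRatio a` attains its supremum; monotonicity
remains strict because `gFun a n` is analytic and not constant. -/
lemma strictMonoOn_gFun (ha : a ≠ 0) (h0 : ∑ q, a q = 0)
    (h1 : ∑ q : Fin (ℓ + 1), ((q : ℕ) : ℝ) * a q = 0)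
    (hb : BddAbove (logRatio a '' Ioo 0 1)) (hn : SampleSizeCond a n) :
    StrictMonoOn (gFun a n) (Ioo 0 1) := by
  have hmono : MonotoneOn (gFun a n) (Ioo 0 1) := by
    refine monotoneOn_of_deriv_nonneg (convex_Ioo 0 1)
      (analyticOnNhd_gFun ha h0 n).continuousOn ?_ ?_
    · rw [interior_Ioo]
      exact (analyticOnNhd_gFun ha h0 n).differentiableOn
    · rw [interior_Ioo]
      intro x hx
      rw [(hasDerivAt_gFun ha h0 n hx).deriv, two_mul_sub_logRatio a n hx]
      have := hn.logRatio_le hb hx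
      linarith
  intro x hx y hy hxy
  refine lt_of_le_of_ne (hmono hx hy hxy.le) fun heq => ?_
  have hmid : (x + y) / 2 ∈ Ioo (0 : ℝ) 1 :=
    ⟨by linarith [hx.1, hy.1], by linarith [hx.2, hy.2]⟩
  have hev : gFun a n =ᶠ[𝓝 ((x + y) / 2)] fun _ => gFun a n x := by
    filter_upwards [Ioo_mem_nhds (show x < (x + y) / 2 by linarith)
      (show (x + y) / 2 < y by linarith)] with z hz
    have hz' : z ∈ Ioo (0 : ℝ) 1 := ⟨hx.1.trans hz.1, hz.2.trans hy.2⟩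
    exact le_antisymm ((hmono hz' hy hz.2.le).trans_eq heq.symm) (hmono hx hz' hz.1.le)
  have hconst := (analyticOnNhd_gFun ha h0 n).eqOn_of_preconnected_of_eventuallyEq
    analyticOnNhd_const isPreconnected_Ioo hmid hev
  obtain ⟨z, hz1, hz⟩ := (((tendsto_gFun_one ha h0 h1 n).eventually_gt_atTop (gFun a n x)).and
    (Ioo_mem_nhdsLT (zero_lt_one' ℝ))).exists
  exact hz1.ne' (hconst hz)

lemma bijOn_gFun (ha : a ≠ 0) (h0 : ∑ q, a q = 0)
    (h1 : ∑ q : Fin (ℓ + 1), ((q : ℕ) : ℝ) * a q = 0)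
    (hmono : StrictMonoOn (gFun a n) (Ioo 0 1)) :
    BijOn (gFun a n) (Ioo 0 1) (Ioi (-Real.log ((∑ q, a q ^ 2) / 2))) := by
  refine ⟨fun x hx => ?_, hmono.injOn, fun y hy => ?_⟩
  · have hx2 : x / 2 ∈ Ioo (0 : ℝ) 1 := ⟨by linarith [hx.1], by linarith [hx.1, hx.2]⟩
    refine lt_of_le_of_lt ?_ (hmono hx2 hx (by linarith [hx.1]))
    refine le_of_tendsto (tendsto_gFun_zero ha h0 n) ?_
    filter_upwards [Ioo_mem_nhdsGT hx2.1] with z hz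
    exact (hmono ⟨hz.1, hz.2.trans hx2.2⟩ hx2 hz.2).le
  · obtain ⟨u, hu1, hu⟩ := (((tendsto_gFun_zero ha h0 n).eventually_lt_const hy).and
      (Ioo_mem_nhdsGT (zero_lt_one' ℝ))).exists
    obtain ⟨v, hv1, hv⟩ := (((tendsto_gFun_one ha h0 h1 n).eventually_gt_atTop y).and
      (Ioo_mem_nhdsLT (zero_lt_one' ℝ))).exists
    exact isPreconnected_Ioo.intermediate_value hu hv
      (analyticOnNhd_gFun ha h0 n).continuousOn ⟨hu1.le, hv1.le⟩

lemma gInv_spec (hy : y ∈ gFun a n '' Ioo 0 1) :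
    gInv a n y ∈ Ioo (0 : ℝ) 1 ∧ gFun a n (gInv a n y) = y := by
  rw [gInv, if_pos hy]
  exact Function.invFunOn_pos hy

lemma gInv_le (hmono : StrictMonoOn (gFun a n) (Ioo 0 1)) (hx : x ∈ Ioo (0 : ℝ) 1)
    (hy : y ≤ gFun a n x) : gInv a n y ≤ x := by
  by_cases h : y ∈ gFun a n '' Ioo 0 1
  · obtain ⟨h1, h2⟩ := gInv_spec h
    rwa [← hmono.le_iff_le h1 hx, h2]
  · rw [gInv, if_neg h]
    exact hx.1.le

lemma le_gInv (ha : a ≠ 0) (h0 : ∑ q, a q = 0)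
    (h1 : ∑ q : Fin (ℓ + 1), ((q : ℕ) : ℝ) * a q = 0)
    (hmono : StrictMonoOn (gFun a n) (Ioo 0 1)) (hx : x ∈ Ioo (0 : ℝ) 1)
    (hy : gFun a n x ≤ y) : x ≤ gInv a n y := by
  have hbij := bijOn_gFun ha h0 h1 hmono
  obtain ⟨h2, h3⟩ := gInv_spec (hbij.surjOn (lt_of_lt_of_le (hbij.mapsTo hx) hy : y ∈ Ioi _))
  rwa [← hmono.le_iff_le hx h2, h3]

end GFun

/-! ### Coverage and asymptotics of the confidence interval -/

section Interval

variable {Ω : Type*} [MeasurableSpace Ω] {P : Measure Ω} [IsProbabilityMeasure P]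
  {B : ℝ → Ω → ℝ} {H : ℝ} {ℓ : ℕ} {a : Fin (ℓ + 1) → ℝ} {n : ℕ} {α β : ℝ}

theorem measure_mem_interval_ge (hH : H ∈ Ioo (0 : ℝ) 1)
    (hB : IsFBM B H 1 P) (ha : a ≠ 0) (h0 : ∑ q, a q = 0)
    (h1 : ∑ q : Fin (ℓ + 1), ((q : ℕ) : ℝ) * a q = 0) (hτ : tau a ≠ 0)
    {α : ℝ} (hα : α ∈ Ioo (0 : ℝ) 1) (hn : ℓ + 1 ≤ n)
    (hmono : StrictMonoOn (gFun a n) (Ioo 0 1)) :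
    ENNReal.ofReal (1 - α) ≤ P {ω | H ∈ Icc (hInf B a α n ω) (hSup B a α n ω)} := by
  refine (measure_bracketing_ge hH hB ha h0 h1 hτ hα hn).trans (measure_mono fun ω hω => ?_)
  exact ⟨max_le hH.1.le (gInv_le hmono hH hω.1),
    le_min hH.2.le (le_gInv ha h0 h1 hmono hH hω.2)⟩

/-- Borel-Cantelli for events of geometrically small probability. -/
lemma ae_eventually_notMem_of_le_pow {s : ℕ → Set Ω} {r : ℝ} (hr0 : 0 ≤ r) (hr1 : r < 1)
    (h : ∀ m, P.real (s m) ≤ r ^ (m + 1)) : ∀ᵐ ω ∂P, ∀ᶠ m in atTop, ω ∉ s m := by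
  refine ae_eventually_notMem ?_
  have hsum : Summable fun m : ℕ => r ^ (m + 1) :=
    (summable_nat_add_iff 1).2 (summable_geometric_of_lt_one hr0 hr1)
  refine ne_top_of_le_ne_top hsum.tsum_ofReal_ne_top (ENNReal.tsum_le_tsum fun m => ?_)
  rw [← ofReal_measureReal]
  exact ENNReal.ofReal_le_ofReal (h m)

lemma logSub_neg {y : ℝ} (hy : -1 < y) (hy0 : y ≠ 0) : logSub y < 0 := by
  have := Real.log_lt_sub_one_of_pos (show 0 < 1 + y by linarith) (by simpa using hy0)
  unfold logSub
  linarith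

/-- The strong law of large numbers for the statistic `S_n^a`: the tail bounds are summable. -/
lemma ae_tendsto_statS_div (hH : H ∈ Ioo (0 : ℝ) 1) (hB : IsFBM B H 1 P) (ha : a ≠ 0)
    (h0 : ∑ q, a q = 0) (h1 : ∑ q : Fin (ℓ + 1), ((q : ℕ) : ℝ) * a q = 0) (hτ : tau a ≠ 0) :
    ∀ᵐ ω ∂P, Tendsto (fun n => statS B a n ω / meanS a H n) atTop (𝓝 1) := by
  have hκ := kappa_pos ha h0 h1 hτ
  have hpow : ∀ y : ℝ, -1 < y → y ≠ 0 →
      Real.exp (logSub y / kappa a) < 1 ∧ ∀ m : ℕ,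
        Real.exp ((m + (ℓ + 1) - ℓ : ℕ) * logSub y / kappa a) =
          Real.exp (logSub y / kappa a) ^ (m + 1) := by
    intro y hy hy0
    refine ⟨by
      rw [← Real.exp_zero, Real.exp_lt_exp]
      exact div_neg_of_neg_of_pos (logSub_neg hy hy0) hκ, fun m => ?_⟩
    rw [show m + (ℓ + 1) - ℓ = m + 1 by omega, mul_div_assoc, Real.exp_nat_mul]
  have hae : ∀ k : ℕ, ∀ᵐ ω ∂P, ∀ᶠ m in atTop,
      |statS B a (m + (ℓ + 1)) ω / meanS a H (m + (ℓ + 1)) - 1| < 1 / ((k : ℝ) + 2) := by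
    intro k
    have hε0 : (0 : ℝ) < 1 / ((k : ℝ) + 2) := by positivity
    have hε1 : 1 / ((k : ℝ) + 2) < 1 := by
      rw [div_lt_one (by positivity)]
      linarith [(Nat.cast_nonneg k : (0 : ℝ) ≤ k)]
    obtain ⟨hr, hr'⟩ := hpow (1 / ((k : ℝ) + 2)) (by linarith) hε0.ne'
    obtain ⟨hl, hl'⟩ := hpow (-(1 / ((k : ℝ) + 2))) (by linarith) (neg_ne_zero.2 hε0.ne')
    filter_upwards [ae_eventually_notMem_of_le_pow (P := P) (Real.exp_pos _).le hr fun m =>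
        (measure_statS_ge_le hH hB ha h0 h1 hτ (show ℓ + 1 ≤ m + (ℓ + 1) by omega)
          hε0.le).trans_eq (hr' m),
      ae_eventually_notMem_of_le_pow (P := P) (Real.exp_pos _).le hl fun m =>
        (measure_statS_le_le hH hB ha h0 h1 hτ (show ℓ + 1 ≤ m + (ℓ + 1) by omega)
          hε0.le hε1).trans_eq (hl' m)] with ω hωr hωl
    filter_upwards [hωr, hωl] with m hmr hml
    simp only [not_le] at hmr hml
    have hv := meanS_pos ha h0 hH (show 0 < m + (ℓ + 1) by omega)
    rw [abs_sub_lt_iff, sub_lt_iff_lt_add, sub_lt_comm, div_lt_iff₀ hv, lt_div_iff₀ hv]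
    constructor <;> linarith
  filter_upwards [ae_all_iff.2 hae] with ω hω
  rw [← tendsto_add_atTop_iff_nat (ℓ + 1), Metric.tendsto_atTop']
  intro ε hε
  obtain ⟨k, hk⟩ := exists_nat_one_div_lt hε
  obtain ⟨N, hN⟩ := eventually_atTop.1 (hω k)
  refine ⟨N, fun m hm => ?_⟩
  rw [Real.dist_eq]
  refine (hN m (le_of_lt hm)).trans (lt_of_le_of_lt ?_ hk)
  gcongr
  norm_num

lemma tendsto_log_natCast : Tendsto (fun n : ℕ => Real.log n) atTop atTop :=
  Real.tendsto_log_atTop.comp tendsto_natCast_atTop_atTop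

lemma eventually_sampleSizeCond (a : Fin (ℓ + 1) → ℝ) : ∀ᶠ n in atTop, SampleSizeCond a n :=
  tendsto_natCast_atTop_atTop.eventually_ge_atTop _

/-- Levels close to `gFun a n H` are attained close to `H`, as the slope of `gFun a n` tends to
infinity uniformly. -/
lemma gInv_spec_tendsto (hH : H ∈ Ioo (0 : ℝ) 1) (ha : a ≠ 0) (h0 : ∑ q, a q = 0)
    (h1 : ∑ q : Fin (ℓ + 1), ((q : ℕ) : ℝ) * a q = 0)
    (hb : BddAbove (logRatio a '' Ioo 0 1)) {y : ℕ → ℝ}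
    (hy : Tendsto (fun n => y n - gFun a n H) atTop (𝓝 0)) :
    (∀ᶠ n in atTop, gInv a n (y n) ∈ Ioo (0 : ℝ) 1 ∧ gFun a n (gInv a n (y n)) = y n) ∧
      Tendsto (fun n => gInv a n (y n)) atTop (𝓝 H) := by
  have hg : Tendsto (fun n => gFun a n H) atTop atTop :=
    tendsto_atTop_add_const_right _ _ (tendsto_log_natCast.const_mul_atTop (by linarith [hH.1]))
  have hy' : Tendsto y atTop atTop := by
    refine (hy.add_atTop hg).congr fun n => ?_
    ring
  have hspec : ∀ᶠ n in atTop,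
      gInv a n (y n) ∈ Ioo (0 : ℝ) 1 ∧ gFun a n (gInv a n (y n)) = y n := by
    filter_upwards [eventually_sampleSizeCond a,
      hy'.eventually_gt_atTop (-Real.log ((∑ q, a q ^ 2) / 2))] with n hn hyn
    exact gInv_spec ((bijOn_gFun ha h0 h1 (strictMonoOn_gFun ha h0 h1 hb hn)).surjOn hyn)
  refine ⟨hspec, tendsto_iff_norm_sub_tendsto_zero.2 ?_⟩
  refine squeeze_zero' (Eventually.of_forall fun _ => norm_nonneg _) ?_
    (tendsto_zero_iff_norm_tendsto_zero.1 hy)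
  obtain ⟨M, hM⟩ := hb
  filter_upwards [hspec, tendsto_log_natCast.eventually_ge_atTop (M + 1)] with n hn hlog
  have hslope : ∀ u ∈ Ioo (0 : ℝ) 1, ∀ v ∈ Ioo (0 : ℝ) 1, u ≤ v →
      v - u ≤ gFun a n v - gFun a n u := by
    intro u hu v hv huv
    have h2 := (convex_Ioo (0 : ℝ) 1).mul_sub_le_image_sub_of_le_deriv (f := gFun a n)
      (analyticOnNhd_gFun ha h0 n).continuousOn
      (by rw [interior_Ioo]; exact (analyticOnNhd_gFun ha h0 n).differentiableOn) (C := 1)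
      (by
        rw [interior_Ioo]
        intro x hx
        rw [(hasDerivAt_gFun ha h0 n hx).deriv, two_mul_sub_logRatio a n hx]
        have := hM ⟨x, hx, rfl⟩
        linarith) u hu v hv huv
    rwa [one_mul] at h2
  rw [Real.norm_eq_abs, Real.norm_eq_abs]
  rcases le_total (gInv a n (y n)) H with h | h
  · have h3 := hslope _ hn.1 _ hH h
    rw [abs_of_nonpos (by linarith)]
    rw [hn.2] at h3
    exact le_trans (by linarith) (neg_le_abs _)
  · have h3 := hslope _ hH _ hn.1 h
    rw [abs_of_nonneg (by linarith)]
    rw [hn.2] at h3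
    exact h3.trans (le_abs_self _)

lemma tendsto_deriv_gFun (hH : H ∈ Ioo (0 : ℝ) 1) (ha : a ≠ 0) (h0 : ∑ q, a q = 0) :
    Tendsto (fun n => deriv (gFun a n) H) atTop atTop := by
  simp_rw [(hasDerivAt_gFun ha h0 _ hH).deriv, sub_eq_add_neg]
  exact tendsto_atTop_add_const_right _ _ (tendsto_log_natCast.const_mul_atTop two_pos)

lemma isEquivalent_deriv_gFun (hH : H ∈ Ioo (0 : ℝ) 1) (ha : a ≠ 0) (h0 : ∑ q, a q = 0) :
    (fun n => deriv (gFun a n) H) ~[atTop] fun n : ℕ => 2 * Real.log n := by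
  simp_rw [(hasDerivAt_gFun ha h0 _ hH).deriv]
  refine IsEquivalent.sub_isLittleO IsEquivalent.refl (isLittleO_const_left.2 (Or.inr ?_))
  exact tendsto_norm_atTop_atTop.comp (tendsto_log_natCast.const_mul_atTop two_pos)

/-- Increments of `gFun a n` near `H` are equivalent to the linear ones, uniformly in `n`: only the
linear part of `gFun a n` depends on `n`. -/
lemma isEquivalent_sub_of_gFun_sub (hH : H ∈ Ioo (0 : ℝ) 1) (ha : a ≠ 0) (h0 : ∑ q, a q = 0)
    {u v : ℕ → ℝ} (hu : Tendsto u atTop (𝓝 H)) (hv : Tendsto v atTop (𝓝 H)) {c : ℝ} (hc : c ≠ 0)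
    (hD : Tendsto (fun n : ℕ => √(n : ℝ) * (gFun a n (u n) - gFun a n (v n))) atTop (𝓝 c)) :
    (fun n => u n - v n) ~[atTop] fun n : ℕ => c / √(n : ℝ) * (1 / deriv (gFun a n) H) := by
  have hd := tendsto_deriv_gFun hH ha h0 (a := a)
  have h1 := ((hasStrictDerivAt_log_varFun ha h0 hH).isLittleO).comp_tendsto
    (hu.prodMk_nhds hv)
  have h2 : (fun n => (gFun a n (u n) - gFun a n (v n)) - (u n - v n) * deriv (gFun a n) H)
      =o[atTop] fun n => (u n - v n) * deriv (gFun a n) H := by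
    refine (IsLittleO.congr' h1.neg_left ?_ EventuallyEq.rfl).trans_isBigO ?_
    · filter_upwards [hu.eventually_ne hH.1.ne', hv.eventually_ne hH.1.ne'] with n hun hvn
      rw [gFun_eq a n hun, gFun_eq a n hvn, (hasDerivAt_gFun ha h0 n hH).deriv]
      simp only [Function.comp_apply, ContinuousLinearMap.toSpanSingleton_apply, smul_eq_mul]
      ring
    · refine IsBigO.of_bound 1 ?_
      filter_upwards [hd.eventually_ge_atTop 1] with n hn
      rw [one_mul, norm_mul]
      simp only [Function.comp_apply]
      refine le_mul_of_one_le_right (norm_nonneg _) ?_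
      rw [Real.norm_eq_abs]
      exact hn.trans (le_abs_self _)
  have h3 : (fun n => gFun a n (u n) - gFun a n (v n)) ~[atTop]
      fun n => (u n - v n) * deriv (gFun a n) H := h2
  have h4 : (fun n => gFun a n (u n) - gFun a n (v n)) ~[atTop] fun n : ℕ => c / √(n : ℝ) := by
    have h5 := ((isEquivalent_const_iff_tendsto hc).2 hD).div
      (IsEquivalent.refl (u := fun n : ℕ => √(n : ℝ)))
    refine h5.congr_left ?_
    filter_upwards [eventually_gt_atTop 0] with n hn
    have : 0 < √(n : ℝ) := Real.sqrt_pos.2 (by exact_mod_cast hn)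
    simp only [Pi.div_apply]
    field_simp
  have h6 := (h3.symm.trans h4).mul
    (IsEquivalent.refl (u := fun n => 1 / deriv (gFun a n) H))
  refine h6.congr_left ?_
  filter_upwards [hd.eventually_gt_atTop 0] with n hn
  simp only [Pi.mul_apply]
  field_simp

lemma tendsto_sqrt_natCast : Tendsto (fun m : ℕ => √(m : ℝ)) atTop atTop :=
  Real.tendsto_sqrt_atTop.comp tendsto_natCast_atTop_atTop

lemma tendsto_xR (hκ : 0 < kappa a) (hβ : β ∈ Ioo (0 : ℝ) 1) :
    Tendsto (fun m => xR a m β) atTop (𝓝 1) := by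
  simpa [xR] using ((tendsto_quantR hκ hβ).div_atTop tendsto_sqrt_natCast).const_add 1

lemma tendsto_xL (hκ : 0 < kappa a) (hβ : β ∈ Ioo (0 : ℝ) 1) :
    Tendsto (fun m => xL a m β) atTop (𝓝 1) := by
  simpa [xL] using ((tendsto_quantL hκ hβ).div_atTop tendsto_sqrt_natCast).const_sub 1

/-- The delta method at `1` for the logarithm. -/
lemma tendsto_sqrt_mul_log {q : ℕ → ℝ} {c : ℝ} (hq : Tendsto q atTop (𝓝 c)) :
    Tendsto (fun m : ℕ => √(m : ℝ) * Real.log (1 + q m / √(m : ℝ))) atTop (𝓝 c) := by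
  have h1 : HasDerivAt (fun t : ℝ => Real.log (1 + t)) 1 0 := by
    have := ((hasDerivAt_id (0 : ℝ)).const_add 1).log (by simp)
    simpa using this
  have h2 : ContinuousAt (dslope (fun t : ℝ => Real.log (1 + t)) 0) 0 :=
    continuousAt_dslope_same.2 h1.differentiableAt
  have h3 := h2.tendsto.comp (hq.div_atTop tendsto_sqrt_natCast)
  rw [dslope_same, h1.deriv] at h3
  have h4 := hq.mul h3
  rw [mul_one] at h4
  refine h4.congr' ?_
  filter_upwards [eventually_gt_atTop 0] with m hm
  have hs : 0 < √(m : ℝ) := Real.sqrt_pos.2 (by exact_mod_cast hm)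
  have h5 := sub_smul_dslope (fun t : ℝ => Real.log (1 + t)) 0 (q m / √(m : ℝ))
  simp only [sub_zero, add_zero, Real.log_one, smul_eq_mul] at h5
  rw [Function.comp_apply, ← h5]
  field_simp

lemma tendsto_sqrt_mul_log_sub_log (hκ : 0 < kappa a) (hβ : β ∈ Ioo (0 : ℝ) 1) :
    Tendsto (fun n : ℕ => √(n : ℝ) * (Real.log (xR a (n - ℓ) β) - Real.log (xL a (n - ℓ) β)))
      atTop (𝓝 (2 * quantLim a β)) := by
  have h1 : Tendsto (fun m : ℕ => √(m : ℝ) * (Real.log (xR a m β) - Real.log (xL a m β)))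
      atTop (𝓝 (2 * quantLim a β)) := by
    have h2 := (tendsto_sqrt_mul_log (tendsto_quantR hκ hβ)).sub
      (tendsto_sqrt_mul_log (tendsto_quantL hκ hβ).neg)
    rw [sub_neg_eq_add, ← two_mul] at h2
    refine h2.congr fun m => ?_
    rw [xR, xL, neg_div, ← sub_eq_add_neg]
    ring
  have hratio : Tendsto (fun m : ℕ => √(((m + ℓ : ℕ) : ℝ) / m)) atTop (𝓝 1) := by
    have h3 : Tendsto (fun m : ℕ => ((m + ℓ : ℕ) : ℝ) / m) atTop (𝓝 1) := by
      have h4 := ((tendsto_const_div_atTop_nhds_zero_nat (ℓ : ℝ))).const_add 1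
      rw [add_zero] at h4
      refine h4.congr' ?_
      filter_upwards [eventually_gt_atTop 0] with m hm
      have : (m : ℝ) ≠ 0 := by exact_mod_cast hm.ne'
      push_cast
      field_simp
    simpa using h3.sqrt
  rw [← tendsto_add_atTop_iff_nat ℓ]
  have h5 := hratio.mul h1
  rw [one_mul] at h5
  refine h5.congr' ?_
  filter_upwards [eventually_gt_atTop 0] with m hm
  have hs : 0 < √(m : ℝ) := Real.sqrt_pos.2 (by exact_mod_cast hm)
  rw [Nat.add_sub_cancel, Real.sqrt_div (Nat.cast_nonneg _)]
  field_simp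

theorem ae_interval_asymptotics (hH : H ∈ Ioo (0 : ℝ) 1) (hB : IsFBM B H 1 P) (ha : a ≠ 0)
    (h0 : ∑ q, a q = 0) (h1 : ∑ q : Fin (ℓ + 1), ((q : ℕ) : ℝ) * a q = 0) (hτ : tau a ≠ 0)
    (hb : BddAbove (logRatio a '' Ioo 0 1)) (hα : α ∈ Ioo (0 : ℝ) 1) :
    ∀ᵐ ω ∂P,
      Tendsto (fun n : ℕ => hInf B a α n ω) atTop (𝓝 H) ∧
      Tendsto (fun n : ℕ => hSup B a α n ω) atTop (𝓝 H) ∧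
      (fun n : ℕ => hSup B a α n ω - hInf B a α n ω) ~[atTop]
        (fun n : ℕ => 2 * quantLim a (α / 2) / √(n : ℝ) * (1 / deriv (gFun a n) H)) := by
  have hκ := kappa_pos ha h0 h1 hτ
  have hβ : α / 2 ∈ Ioo (0 : ℝ) 1 := ⟨by linarith [hα.1], by linarith [hα.2]⟩
  filter_upwards [ae_tendsto_statS_div hH hB ha h0 h1 hτ] with ω hω
  have hshift : ∀ {x : ℕ → ℝ}, Tendsto x atTop (𝓝 1) →
      Tendsto (fun n => Real.log (x (n - ℓ)) - Real.log (statS B a n ω) - gFun a n H)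
        atTop (𝓝 0) := by
    intro x hx
    have h2 := ((hx.comp (tendsto_sub_atTop_nat ℓ)).log one_ne_zero).sub (hω.log one_ne_zero)
    rw [sub_self] at h2
    refine h2.congr' ?_
    filter_upwards [(tendsto_order.1 hω).1 0 one_pos, eventually_gt_atTop 0] with n hpos hn
    have hv := meanS_pos ha h0 hH hn
    have hS : statS B a n ω ≠ 0 := fun h => by simp [h] at hpos
    rw [Real.log_div hS hv.ne', log_meanS ha h0 hH hn]
    simp only [Function.comp_apply]
    ring
  obtain ⟨hL, hLt⟩ := gInv_spec_tendsto hH ha h0 h1 hb (hshift (tendsto_xL hκ hβ))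
  obtain ⟨hU, hUt⟩ := gInv_spec_tendsto hH ha h0 h1 hb (hshift (tendsto_xR hκ hβ))
  have hInf_eq : ∀ᶠ n in atTop, gInv a n (lowerB B a α n ω) = hInf B a α n ω := by
    filter_upwards [hL] with n hn
    exact (max_eq_right hn.1.1.le).symm
  have hSup_eq : ∀ᶠ n in atTop, gInv a n (upperB B a α n ω) = hSup B a α n ω := by
    filter_upwards [hU] with n hn
    exact (min_eq_right hn.1.2.le).symm
  refine ⟨hLt.congr' hInf_eq, hUt.congr' hSup_eq, ?_⟩
  have hc : 2 * quantLim a (α / 2) ≠ 0 := (mul_pos two_pos (quantLim_pos hκ hβ)).ne'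
  refine (isEquivalent_sub_of_gFun_sub hH ha h0 hUt hLt hc ?_).congr_left ?_
  · refine (tendsto_sqrt_mul_log_sub_log hκ hβ).congr' ?_
    filter_upwards [hL, hU] with n hLn hUn
    rw [hLn.2, hUn.2]
    ring
  · filter_upwards [hInf_eq, hSup_eq] with n h2 h3
    rw [← h2, ← h3]
    rfl

lemma isEquivalent_length (hH : H ∈ Ioo (0 : ℝ) 1) (ha : a ≠ 0) (h0 : ∑ q, a q = 0) (c : ℝ) :
    (fun n : ℕ => 2 * c / √(n : ℝ) * (1 / deriv (gFun a n) H)) ~[atTop]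
      fun n : ℕ => c / (√(n : ℝ) * Real.log n) := by
  have h1 := (IsEquivalent.refl (u := fun n : ℕ => 2 * c / √(n : ℝ))).mul
    (isEquivalent_deriv_gFun hH ha h0).inv
  refine (h1.congr_left ?_).congr_right ?_
  · exact Eventually.of_forall fun n => by simp
  · refine Eventually.of_forall fun n => ?_
    simp only [Pi.mul_apply, Pi.inv_apply]
    rw [mul_comm 2 c, mul_div_right_comm, mul_assoc, mul_inv, mul_inv_cancel_left₀ two_ne_zero,
      ← div_eq_mul_inv, div_div]

end Interval

end HurstCI

open HurstCI
theorem proposition4 {Ω : Type*} [MeasurableSpace Ω] (P : Measure Ω) [IsProbabilityMeasure P]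
    (B : ℝ → Ω → ℝ) (H : ℝ) (hH : H ∈ Ioo (0 : ℝ) 1) (hB : IsFBM B H 1 P)
    {ℓ : ℕ} (a : Fin (ℓ + 1) → ℝ) (p : ℕ) (hp : 2 ≤ p) (ha : IsFilterOfOrder a p)
    (hHa : tau a ≠ 0) (α : ℝ) (hα : α ∈ Ioo (0 : ℝ) 1) :
    -- the constant `κ^a` is finite
    ((∀ x ∈ Ioo (0 : ℝ) 1, Summable fun j : ℤ => |corrFun a x j|) ∧
      BddAbove (corrNorm a '' Ioo 0 1)) ∧
    -- bracketing of `g_n(H)`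
    (∀ n : ℕ, ℓ + 1 ≤ n →
      ENNReal.ofReal (1 - α) ≤
        P {ω | lowerB B a α n ω ≤ gFun a n H ∧ gFun a n H ≤ upperB B a α n ω}) ∧
    (0 ≤ tau a →
      -- the supremum in the condition on `n` is finite
      BddAbove (logRatio a '' Ioo 0 1) ∧
      -- confidence interval for `H`
      (∀ n : ℕ, ℓ + 1 ≤ n → SampleSizeCond a n →
        StrictMonoOn (gFun a n) (Ioo 0 1) ∧
        BijOn (gFun a n) (Ioo 0 1) (Ioi (-Real.log ((∑ q, a q ^ 2) / 2))) ∧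
        ENNReal.ofReal (1 - α) ≤ P {ω | H ∈ Icc (hInf B a α n ω) (hSup B a α n ω)}) ∧
      -- asymptotics
      (∀ᵐ ω ∂P,
        Tendsto (fun n : ℕ => hInf B a α n ω) atTop (𝓝 H) ∧
        Tendsto (fun n : ℕ => hSup B a α n ω) atTop (𝓝 H) ∧
        (fun n : ℕ => hSup B a α n ω - hInf B a α n ω) ~[atTop]
          (fun n : ℕ => 2 * quantLim a (α / 2) / √(n : ℝ) * (1 / deriv (gFun a n) H))) ∧
      (fun n : ℕ => 2 * quantLim a (α / 2) / √(n : ℝ) * (1 / deriv (gFun a n) H)) ~[atTop]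
        (fun n : ℕ => quantLim a (α / 2) / (√(n : ℝ) * Real.log n))) := by
  have h0 := ha.sum_eq_zero hp
  have h1 := ha.sum_mul_eq_zero hp
  have hne := ha.ne_zero
  refine ⟨⟨fun x hx => summable_corrFun hne h0 h1 hHa hx, bddAbove_corrNorm hne h0 h1 hHa⟩,
    fun n hn => measure_bracketing_ge hH hB hne h0 h1 hHa hα hn, fun hτ => ?_⟩
  have hb := bddAbove_logRatio hne h0 (lt_of_le_of_ne hτ hHa.symm)
  refine ⟨hb, fun n hn hcond => ?_, ae_interval_asymptotics hH hB hne h0 h1 hHa hb hα,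
    isEquivalent_length hH hne h0 _⟩
  have hmono := strictMonoOn_gFun hne h0 h1 hb hcond
  exact ⟨hmono, bijOn_gFun hne h0 h1 hmono, measure_mem_interval_ge hH hB hne h0 h1 hHa hα hn hmono⟩
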